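/- **Notation.** Let $\partial=\frac12(\partial_1-i\partial_2)$, $\bar\partial=\frac12(\partial_1+i\partial_2)$ for $\xi=\xi^1+i\xi^2\in\mathbb C$. Let $\Omega\subset\mathbb C$ be open and $f:\Omega\to\mathbb C^{N+1}\setminus\{0\}$ smooth; $\partial f^\dagger$ means $\partial(f^\dagger)$. Put $$P=\mathbf 1-\frac{f\otimes f^\dagger}{f^\dagger f},\qquad \mathbb K=[\bar\partial P,P],\qquad J=\frac{\partial f^\dagger P\,\partial f}{f^\dagger f},$$ and call $f$ a solution of the $\mathbb CP^N$ sigma model on $U\subset\Omega$ if on $U$ $$P\Big[\partial\bar\partial f-\frac1{f^\dagger f}\big((f^\dagger\bar\partial f)\,\partial f+(f^\dagger\partial f)\,\bar\partial f\big)\Big]=0.\tag{1}$$ On $\mathfrak{su}(N+1)$ use the inner product $(X,Y)=-\operatorname{tr}(XY)$, extended complex bilinearly. Given complex tangent fields $E_1,E_2$ and a mixed second derivative $M$ (for a surface $X$: $E_1=\partial X$, $E_2=\bar\partial X$, $M=\partial\bar\partial X$), put $g_{\xi\xi}=(E_1,E_1)$, $g_{\bar\xi\bar\xi}=(E_2,E_2)$,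 $g_{\xi\bar\xi}=(E_1,E_2)$, $g=g_{\xi\xi}g_{\bar\xi\bar\xi}-g_{\xi\bar\xi}^2$. A *moving frame* on an open set is $\eta=(\eta_1=E_1,\eta_2=E_2,\eta_3,\dots,\eta_{N(N+2)})$ with smooth $\mathfrak{su}(N+1)$-valued $\eta_k$, $k\ge3$, such that $(E_1,\eta_k)=(E_2,\eta_k)=0$ and $(\eta_j,\eta_k)=\delta_{jk}$. For it put $J_k=(\partial E_1,\eta_k)$, $H_k=(M,\eta_k)$, $S_{jk}=(\partial\eta_j,\eta_k)$ $(j,k\ge3)$ and $$A=\begin{pmatrix}a_{1,1}&a_{1,2}&J_k\\0&0&H_k\\ \alpha_{1,j}&\beta_{1,j}&S_{jk}\end{pmatrix},\qquad B=\begin{pmatrix}0&0&H_k\\a_{2,1}&a_{2,2}&\bar J_k\\ \alpha_{2,j}&\beta_{2,j}&\bar S_{jk}\end{pmatrix},$$ $$\alpha_{1,j}=\tfrac1g(H_jg_{\xi\bar\xi}-J_jg_{\bar\xi\bar\xi}),\quad \beta_{1,j}=\tfrac1g(J_jg_{\xi\bar\xi}-H_jg_{\xi\xi}),\quad \alpha_{2,j}=\tfrac1g(\bar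 J_jg_{\xi\bar\xi}-H_jg_{\bar\xi\bar\xi}),\quad \beta_{2,j}=\tfrac1g(H_jg_{\xi\bar\xi}-\bar J_jg_{\xi\xi}),$$ $$a_{1,1}=\overline{a_{2,2}}=\frac1g\Big\{\frac{(2\bar J\,\partial f^\dagger-g_{\xi\bar\xi}\bar\partial f^\dagger)P\,\partial^2f+\partial^2f^\dagger P\,(2\bar J\,\partial f-g_{\xi\bar\xi}\bar\partial f)}{f^\dagger f}+\frac{2g_{\xi\bar\xi}}{(f^\dagger f)^2}R-\frac{4(f^\dagger\partial f+\partial f^\dagger f)}{f^\dagger f}|J|^2\Big\},$$ $$a_{1,2}=\overline{a_{2,1}}=\frac1g\Big\{\frac{(g_{\xi\bar\xi}\,\partial f^\dagger-2J\bar\partial f^\dagger)P\,\partial^2f+\partial^2f^\dagger P\,(g_{\xi\bar\xi}\,\partial f-2J\bar\partial f)}{f^\dagger f}+\frac{4J}{(f^\dagger f)^2}R-\frac{2(f^\dagger\partial f+\partial f^\dagger f)}{f^\dagger f}J\,g_{\xi\bar\xi}\Big\},$$ where $R=(f^\dagger\partial f)(\bar\partial f^\dagger P\partial f)+(\partial f^\dagger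 f)(\partial f^\dagger P\bar\partial f)$. **Theorem.** Let $f:\Omega\to\mathbb C^{N+1}\setminus\{0\}$ be smooth. (a) Suppose $f$ is a solution of (1) on $\Omega$, and let $D\subset\Omega$ be an open disc centred at a point $p$. Then there is a surface $X:D\to\mathfrak{su}(N+1)$ with $dX=i(\mathbb K^\dagger d\xi+\mathbb K\,d\bar\xi)$. If, for such an $X$, the determinant $g$ of the induced metric (formed with $E_1=\partial X$, $E_2=\bar\partial X$) vanishes nowhere on $D$, then there is on $D$ a moving frame $\eta=(\partial X,\bar\partial X,\eta_3,\dots,\eta_{N(N+2)})$. Every such moving frame is linearly independent at each point of $D$ and satisfies the Gauss–Weingarten equations $$\partial\eta_i=\sum_lA_{il}\eta_l,\qquad \bar\partial\eta_i=\sum_lB_{il}\eta_l,$$ with $A$, $B$ as above formed with $M=\partial\bar\partial X$, where $S_{jk}+S_{kj}=0$; and the Gauss–Codazzi–Ricci equations $\bar\partial A-\partial B+[A,B]=0$ hold on $D$. (b) The Gauss–Codazzi–Ricci equations coincide with the equations of the $\mathbb CP^N$ model: without assuming that $f$ is a solution, put $E_1=i\mathbb K^\dagger$, $E_2=i\mathbb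 K$, $M=-i[\partial P,\bar\partial P]$ (these are $\partial X$, $\bar\partial X$, $\partial\bar\partial X$ when $f$ is a solution). If $U\subset\Omega$ is open, $g$ vanishes nowhere on $U$, and $\eta$ is a moving frame on $U$, then $\bar\partial A-\partial B+[A,B]=0$ on $U$ if and only if $f$ satisfies (1) on $U$. -/

import Mathlib

open scoped ContDiff Matrix

noncomputable section

namespace CPN

/-- The holomorphic derivative `∂ = (∂₁ - i ∂₂) / 2` of a scalar function of `ξ = ξ¹ + i ξ²`. -/
def dz (h : ℂ → ℂ) (ξ : ℂ) : ℂ :=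
  (1 / 2) * (fderiv ℝ h ξ 1 - Complex.I * fderiv ℝ h ξ Complex.I)

/-- The antiholomorphic derivative `∂̄ = (∂₁ + i ∂₂) / 2` of a scalar function. -/
def dzb (h : ℂ → ℂ) (ξ : ℂ) : ℂ :=
  (1 / 2) * (fderiv ℝ h ξ 1 + Complex.I * fderiv ℝ h ξ Complex.I)

/-- `∂` of a vector valued function, componentwise. -/
def dzV {m : Type*} (v : ℂ → m → ℂ) (ξ : ℂ) : m → ℂ := fun i => dz (fun ζ => v ζ i) ξ

/-- `∂̄` of a vector valued function, componentwise. -/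
def dzbV {m : Type*} (v : ℂ → m → ℂ) (ξ : ℂ) : m → ℂ := fun i => dzb (fun ζ => v ζ i) ξ

/-- `∂` of a matrix valued function, entrywise. -/
def dzM {m n : Type*} (M : ℂ → Matrix m n ℂ) (ξ : ℂ) : Matrix m n ℂ :=
  Matrix.of fun i j => dz (fun ζ => M ζ i j) ξ

/-- `∂̄` of a matrix valued function, entrywise. -/
def dzbM {m n : Type*} (M : ℂ → Matrix m n ℂ) (ξ : ℂ) : Matrix m n ℂ :=
  Matrix.of fun i j => dzb (fun ζ => M ζ i j) ξ

/-- Square complex matrices of size `N + 1`. -/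
abbrev Mat (N : ℕ) : Type := Matrix (Fin (N + 1)) (Fin (N + 1)) ℂ

/-- The commutator `[A, B]`. -/
def comm {m : Type*} [Fintype m] (A B : Matrix m m ℂ) : Matrix m m ℂ := A * B - B * A

/-- The Lie algebra `su(N+1)` of traceless skew-hermitian matrices. -/
def su (N : ℕ) : Set (Mat N) := {X | Xᴴ = -X ∧ X.trace = 0}

/-- The inner product `(X, Y) = -tr (X Y)` of `su(N+1)`, extended complex bilinearly. -/
def ip {N : ℕ} (X Y : Mat N) : ℂ := -(X * Y).trace

section Model

variable {N : ℕ} (f : ℂ → Fin (N + 1) → ℂ)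

/-- The field `f†`. -/
def fd (ξ : ℂ) : Fin (N + 1) → ℂ := star (f ξ)

/-- The scalar `f† f`. -/
def nf (ξ : ℂ) : ℂ := fd f ξ ⬝ᵥ f ξ

/-- The projector `P = 1 - (f† f)⁻¹ f ⊗ f†`. -/
def P (ξ : ℂ) : Mat N := 1 - (nf f ξ)⁻¹ • Matrix.vecMulVec (f ξ) (fd f ξ)

/-- `f` satisfies the equations of the `CP^N` sigma model at every point of `U`. -/
def IsSolution (U : Set ℂ) : Prop :=
  ∀ ξ ∈ U, P f ξ *ᵥ (dzV (dzbV f) ξ - (nf f ξ)⁻¹ •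
    ((fd f ξ ⬝ᵥ dzbV f ξ) • dzV f ξ + (fd f ξ ⬝ᵥ dzV f ξ) • dzbV f ξ)) = 0

/-- The matrix `K = [∂̄P, P]`. -/
def K (ξ : ℂ) : Mat N := comm (dzbM (P f) ξ) (P f ξ)

/-- The matrix `i K†`. -/
def T₁ (ξ : ℂ) : Mat N := Complex.I • (K f ξ)ᴴ

/-- The matrix `i K`. -/
def T₂ (ξ : ℂ) : Mat N := Complex.I • K f ξ

/-- The matrix `-i [∂P, ∂̄P]`, which is the common value of `∂̄(i K†)` and `∂(i K)`
when `f` is a solution, and half of their sum for every `f`. -/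
def T₁₂ (ξ : ℂ) : Mat N := -(Complex.I • comm (dzM (P f) ξ) (dzbM (P f) ξ))

/-- `X` is, on `U`, a surface in `su(N+1)` with `dX = i (K† dξ + K dξ̄)`. -/
structure IsSurface (X : ℂ → Mat N) (U : Set ℂ) : Prop where
  mem : ∀ ξ ∈ U, X ξ ∈ su N
  hasFDerivAt : ∀ ξ ∈ U, ∀ i j, HasFDerivAt (fun ζ => X ζ i j)
    ((Complex.I * (K f ξ)ᴴ i j) • ContinuousLinearMap.id ℝ ℂ +
      (Complex.I * K f ξ i j) • (Complex.conjCLE : ℂ →L[ℝ] ℂ)) ξ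

/-- The sandwich `x P y` of a row `x`, the projector `P` and a column `y`. -/
def sw (ξ : ℂ) (x y : Fin (N + 1) → ℂ) : ℂ := x ⬝ᵥ (P f ξ *ᵥ y)

/-- The function `J = (f† f)⁻¹ ∂f† P ∂f`, where `∂f†` means `∂(f†)`. -/
def J (ξ : ℂ) : ℂ := (nf f ξ)⁻¹ * sw f ξ (dzV (fd f) ξ) (dzV f ξ)

end Model

section Structural

variable {N : ℕ}

/- In this section `E₁` and `E₂` are the two complex tangent vector fields (`∂X` and `∂̄X` for
a surface `X`), `M` is the mixed second derivative (`∂∂̄X`), and `ν` is the list of the normal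
fields `η_3, …, η_{N(N+2)}`. -/

/-- The determinant `g = g_{ξξ} g_{ξ̄ξ̄} - g_{ξξ̄}²` of the metric with respect to `E₁`, `E₂`. -/
def metricDet (E₁ E₂ : ℂ → Mat N) (ξ : ℂ) : ℂ :=
  ip (E₁ ξ) (E₁ ξ) * ip (E₂ ξ) (E₂ ξ) - ip (E₁ ξ) (E₂ ξ) ^ 2

/-- `ν` is a smooth orthonormal family of `N(N+2) - 2` normal fields with values in `su(N+1)`. -/
structure IsNormalFrame (E₁ E₂ : ℂ → Mat N) (ν : Fin (N * (N + 2) - 2) → ℂ → Mat N)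
    (U : Set ℂ) : Prop where
  smooth : ∀ k i j, ContDiffOn ℝ ∞ (fun ξ => ν k ξ i j) U
  mem : ∀ k, ∀ ξ ∈ U, ν k ξ ∈ su N
  orth₁ : ∀ k, ∀ ξ ∈ U, ip (E₁ ξ) (ν k ξ) = 0
  orth₂ : ∀ k, ∀ ξ ∈ U, ip (E₂ ξ) (ν k ξ) = 0
  orthonormal : ∀ j k, ∀ ξ ∈ U, ip (ν j ξ) (ν k ξ) = if j = k then 1 else 0

/-- The index set of the frame: two tangent and `N(N+2) - 2` normal indices. -/
abbrev Idx (N : ℕ) : Type := Fin 2 ⊕ Fin (N * (N + 2) - 2)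

/-- The moving frame `η = (E₁, E₂, η_3, …, η_{N(N+2)})`. -/
def frame (E₁ E₂ : ℂ → Mat N) (ν : Fin (N * (N + 2) - 2) → ℂ → Mat N) : Idx N → ℂ → Mat N :=
  Sum.elim ![E₁, E₂] ν

/-- The coefficient `a_{1,1}`. -/
def a₁₁ (f : ℂ → Fin (N + 1) → ℂ) (E₁ E₂ : ℂ → Mat N) (ξ : ℂ) : ℂ :=
  let q := ip (E₁ ξ) (E₂ ξ)
  let n := nf f ξ
  let Jc := star (J f ξ)
  (metricDet E₁ E₂ ξ)⁻¹ *
    (n⁻¹ * (sw f ξ ((2 * Jc) • dzV (fd f) ξ - q • dzbV (fd f) ξ) (dzV (dzV f) ξ)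
        + sw f ξ (dzV (dzV (fd f)) ξ) ((2 * Jc) • dzV f ξ - q • dzbV f ξ))
      + 2 * q / n ^ 2 *
        ((fd f ξ ⬝ᵥ dzV f ξ) * sw f ξ (dzbV (fd f) ξ) (dzV f ξ)
          + (dzV (fd f) ξ ⬝ᵥ f ξ) * sw f ξ (dzV (fd f) ξ) (dzbV f ξ))
      - 4 * (fd f ξ ⬝ᵥ dzV f ξ + dzV (fd f) ξ ⬝ᵥ f ξ) / n * (J f ξ * Jc))

/-- The coefficient `a_{1,2}`. -/
def a₁₂ (f : ℂ → Fin (N + 1) → ℂ) (E₁ E₂ : ℂ → Mat N) (ξ : ℂ) : ℂ :=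
  let q := ip (E₁ ξ) (E₂ ξ)
  let n := nf f ξ
  (metricDet E₁ E₂ ξ)⁻¹ *
    (n⁻¹ * (sw f ξ (q • dzV (fd f) ξ - (2 * J f ξ) • dzbV (fd f) ξ) (dzV (dzV f) ξ)
        + sw f ξ (dzV (dzV (fd f)) ξ) (q • dzV f ξ - (2 * J f ξ) • dzbV f ξ))
      + 4 * J f ξ / n ^ 2 *
        ((fd f ξ ⬝ᵥ dzV f ξ) * sw f ξ (dzbV (fd f) ξ) (dzV f ξ)
          + (dzV (fd f) ξ ⬝ᵥ f ξ) * sw f ξ (dzV (fd f) ξ) (dzbV f ξ))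
      - 2 * (fd f ξ ⬝ᵥ dzV f ξ + dzV (fd f) ξ ⬝ᵥ f ξ) / n * (J f ξ * q))

/-- The coefficient `J_k = (∂E₁, η_k)`, that is `(∂²X, η_k)`. -/
def Jn (E₁ : ℂ → Mat N) (ν : Fin (N * (N + 2) - 2) → ℂ → Mat N) (ξ : ℂ)
    (k : Fin (N * (N + 2) - 2)) : ℂ := ip (dzM E₁ ξ) (ν k ξ)

/-- The coefficient `H_k = (M, η_k)`, that is `(∂∂̄X, η_k)`. -/
def Hn (M : ℂ → Mat N) (ν : Fin (N * (N + 2) - 2) → ℂ → Mat N) (ξ : ℂ)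
    (k : Fin (N * (N + 2) - 2)) : ℂ := ip (M ξ) (ν k ξ)

/-- The coefficient `S_{jk} = (∂η_j, η_k)`. -/
def S (ν : Fin (N * (N + 2) - 2) → ℂ → Mat N) (ξ : ℂ) :
    Matrix (Fin (N * (N + 2) - 2)) (Fin (N * (N + 2) - 2)) ℂ :=
  Matrix.of fun j k => ip (dzM (ν j) ξ) (ν k ξ)

/-- The matrix `A`. -/
def A (f : ℂ → Fin (N + 1) → ℂ) (E₁ E₂ M : ℂ → Mat N)
    (ν : Fin (N * (N + 2) - 2) → ℂ → Mat N) (ξ : ℂ) : Matrix (Idx N) (Idx N) ℂ :=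
  let gxx := ip (E₁ ξ) (E₁ ξ)
  let gxy := ip (E₁ ξ) (E₂ ξ)
  let gyy := ip (E₂ ξ) (E₂ ξ)
  let g := metricDet E₁ E₂ ξ
  Matrix.fromBlocks
    !![a₁₁ f E₁ E₂ ξ, a₁₂ f E₁ E₂ ξ; 0, 0]
    (Matrix.of ![fun k => Jn E₁ ν ξ k, fun k => Hn M ν ξ k])
    (Matrix.of fun j => ![g⁻¹ * (Hn M ν ξ j * gxy - Jn E₁ ν ξ j * gyy),
      g⁻¹ * (Jn E₁ ν ξ j * gxy - Hn M ν ξ j * gxx)])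
    (S ν ξ)

/-- The matrix `B`; its bottom right block is the entrywise complex conjugate of `S`. -/
def B (f : ℂ → Fin (N + 1) → ℂ) (E₁ E₂ M : ℂ → Mat N)
    (ν : Fin (N * (N + 2) - 2) → ℂ → Mat N) (ξ : ℂ) : Matrix (Idx N) (Idx N) ℂ :=
  let gxx := ip (E₁ ξ) (E₁ ξ)
  let gxy := ip (E₁ ξ) (E₂ ξ)
  let gyy := ip (E₂ ξ) (E₂ ξ)
  let g := metricDet E₁ E₂ ξ
  Matrix.fromBlocks
    !![0, 0; star (a₁₂ f E₁ E₂ ξ), star (a₁₁ f E₁ E₂ ξ)]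
    (Matrix.of ![fun k => Hn M ν ξ k, fun k => star (Jn E₁ ν ξ k)])
    (Matrix.of fun j => ![g⁻¹ * (star (Jn E₁ ν ξ j) * gxy - Hn M ν ξ j * gyy),
      g⁻¹ * (Hn M ν ξ j * gxy - star (Jn E₁ ν ξ j) * gxx)])
    ((S ν ξ).map star)

/-- The Gauss-Weingarten equations `∂η = A η`, `∂̄η = B η` on `U`. -/
def GaussWeingarten (η : Idx N → ℂ → Mat N) (a b : ℂ → Matrix (Idx N) (Idx N) ℂ)
    (U : Set ℂ) : Prop :=
  ∀ ξ ∈ U, ∀ i, dzM (η i) ξ = ∑ l, a ξ i l • η l ξ ∧ dzbM (η i) ξ = ∑ l, b ξ i l • η l ξ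

/-- The Gauss-Codazzi-Ricci equations `∂̄A - ∂B + [A, B] = 0` on `U`. -/
def GaussCodazziRicci (a b : ℂ → Matrix (Idx N) (Idx N) ℂ) (U : Set ℂ) : Prop :=
  ∀ ξ ∈ U, dzbM a ξ - dzM b ξ + comm (a ξ) (b ξ) = 0

end Structural

end CPN

end

noncomputable section

namespace CPN

/-! Split `ℂ^{N+1}` orthogonally into the line of `f` and its complement, onto which `P` projects. A
commutator with `P` is off-diagonal for this splitting, and so is every first derivative of `P`; a
product of two first derivatives of `P` is block diagonal. Put `W = [∂∂̄P, P]` (`W`). Then `∂(iK) =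
M + iW` and `∂̄(iK†) = M - iW` with `M = -i[∂P, ∂̄P]`. Since `W` is off-diagonal and skew-hermitian,
it is determined by the column `P W f`, which is the left side of (1). So (1) says `W = 0`, that is,
the form `i(K† dξ + K dξ̄)` is closed (`Regular.W_eq_zero_iff`, `Regular.dzM_T₂`,
`Regular.dzbM_T₁`).

Part (a). A closed form on a disc is exact, and the entrywise primitives can be corrected to lie in
`su(N+1)` (`exists_isSurface`). Normal fields come from Householder reflections after a general
position argument, and from the cross product when `N = 1` (`exists_isNormalFrame`). A moving frame
is a basis of `sl(N+1)` by a dimension count. The entries of `A` and `B` are the coefficients of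
`∂η` and `∂̄η` in it, the tangential ones by Cramer's rule, so the Gauss–Weingarten equations hold.
The Gauss–Codazzi–Ricci equations are then `∂̄∂η = ∂∂̄η`, read off by independence.

Part (b). For general `f` the Gauss–Weingarten equations fail by defects that are combinations of
`W`, `T₁` and `T₂`, all annihilated by `Z ↦ PZP`. The first row of the curvature equation applied to
the frame reads `0 = -i∂W +` (a combination of defects), so it forces `P ∂W P = 0` (`sum_curvature`,
`IsMovingFrame.W_eq_zero`). Together with `PWP = 0` this makes `P∂f` and `P∂̄f` multiples of the
tension wherever the tension is nonzero; there the metric would degenerate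
(`Regular.W_eq_zero_of_sandwich`). -/

/-- The first order operator `(∂₁ + c ∂₂) / 2`; it is `∂` for `c = -i` and `∂̄` for `c = i`. -/
def dW (c : ℂ) (h : ℂ → ℂ) (ξ : ℂ) : ℂ :=
  (1 / 2) * (fderiv ℝ h ξ 1 + c * fderiv ℝ h ξ Complex.I)

/-- `dW` of a vector valued function, componentwise. -/
def dWV {m : Type*} (c : ℂ) (v : ℂ → m → ℂ) (ξ : ℂ) : m → ℂ := fun i => dW c (fun ζ => v ζ i) ξ

/-- `dW` of a matrix valued function, entrywise. -/
def dWM {m n : Type*} (c : ℂ) (M : ℂ → Matrix m n ℂ) (ξ : ℂ) : Matrix m n ℂ :=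
  Matrix.of fun i j => dW c (fun ζ => M ζ i j) ξ

lemma dz_eq : dz = dW (-Complex.I) := by
  funext h ξ; simp only [dz, dW]; ring

lemma dzb_eq : dzb = dW Complex.I := rfl

lemma dzV_eq {m : Type*} : @dzV m = dWV (-Complex.I) := by
  funext v ξ i; simp only [dzV, dWV, dz_eq]

lemma dzbV_eq {m : Type*} : @dzbV m = dWV Complex.I := rfl

lemma dzM_eq {m n : Type*} : @dzM m n = dWM (-Complex.I) := by
  funext v ξ; simp only [dzM, dWM, dz_eq]

lemma dzbM_eq {m n : Type*} : @dzbM m n = dWM Complex.I := rfl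

/-- Smoothness of a vector valued function at a point, componentwise. -/
def SmV {m : Type*} (v : ℂ → m → ℂ) (ξ : ℂ) : Prop := ∀ i, ContDiffAt ℝ ∞ (fun ζ => v ζ i) ξ

/-- Smoothness of a matrix valued function at a point, entrywise. -/
def SmM {m n : Type*} (M : ℂ → Matrix m n ℂ) (ξ : ℂ) : Prop :=
  ∀ i j, ContDiffAt ℝ ∞ (fun ζ => M ζ i j) ξ

/-! ### Wirtinger calculus for scalar, vector and matrix fields. -/

section Scalar

variable {c : ℂ} {g h : ℂ → ℂ} {ξ : ℂ}

lemma diffAt (hg : ContDiffAt ℝ ∞ g ξ) : DifferentiableAt ℝ g ξ :=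
  hg.differentiableAt (by simp)

lemma smooth_dW (c : ℂ) (hg : ContDiffAt ℝ ∞ g ξ) : ContDiffAt ℝ ∞ (dW c g) ξ := by
  have h1 : ContDiffAt ℝ ∞ (fderiv ℝ g) ξ := hg.fderiv_right (by simp)
  unfold dW
  exact contDiffAt_const.mul ((h1.clm_apply contDiffAt_const).add
    (contDiffAt_const.mul (h1.clm_apply contDiffAt_const)))

lemma smooth_star (hg : ContDiffAt ℝ ∞ g ξ) : ContDiffAt ℝ ∞ (fun ζ => star (g ζ)) ξ :=
  (Complex.conjCLE : ℂ →L[ℝ] ℂ).contDiff.contDiffAt.comp ξ hg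

lemma dW_congr (c : ℂ) (hgh : g =ᶠ[nhds ξ] h) : dW c g ξ = dW c h ξ := by
  simp only [dW, hgh.fderiv_eq]

lemma dW_const (c a : ℂ) : dW c (fun _ => a) ξ = 0 := by simp [dW]

lemma dW_sub (c : ℂ) (hg : DifferentiableAt ℝ g ξ) (hh : DifferentiableAt ℝ h ξ) :
    dW c (fun ζ => g ζ - h ζ) ξ = dW c g ξ - dW c h ξ := by
  simp only [dW]; rw [fderiv_fun_sub hg hh]; simp only [sub_apply]; ring

lemma dW_neg (c : ℂ) : dW c (fun ζ => -g ζ) ξ = -dW c g ξ := by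
  simp only [dW]; rw [fderiv_fun_neg]; simp only [neg_apply]; ring

lemma dW_mul (c : ℂ) (hg : DifferentiableAt ℝ g ξ) (hh : DifferentiableAt ℝ h ξ) :
    dW c (fun ζ => g ζ * h ζ) ξ = dW c g ξ * h ξ + g ξ * dW c h ξ := by
  simp only [dW]; rw [fderiv_fun_mul hg hh]
  simp only [add_apply, smul_apply, smul_eq_mul]; ring

lemma dW_sum {ι : Type*} (c : ℂ) (s : Finset ι) (F : ι → ℂ → ℂ)
    (hF : ∀ i ∈ s, DifferentiableAt ℝ (F i) ξ) :
    dW c (fun ζ => ∑ i ∈ s, F i ζ) ξ = ∑ i ∈ s, dW c (F i) ξ := by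
  simp only [dW]; rw [fderiv_fun_sum hF]
  simp only [sum_apply, Finset.mul_sum, mul_add, Finset.sum_add_distrib]

lemma dW_star (c : ℂ) (g : ℂ → ℂ) (ξ : ℂ) :
    dW c (fun ζ => star (g ζ)) ξ = star (dW (star c) g ξ) := by
  have h1 : fderiv ℝ (fun ζ => star (g ζ)) ξ = (Complex.conjCLE : ℂ →L[ℝ] ℂ).comp (fderiv ℝ g ξ) :=
    Complex.conjCLE.comp_fderiv
  simp only [dW, h1]
  simp

lemma dW_comm (c d : ℂ) (hg : ContDiffAt ℝ ∞ g ξ) : dW c (dW d g) ξ = dW d (dW c g) ξ := by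
  have h1 : DifferentiableAt ℝ (fderiv ℝ g) ξ :=
    (hg.fderiv_right (m := ∞) (by simp)).differentiableAt (by simp)
  have hs : IsSymmSndFDerivAt ℝ g ξ := hg.isSymmSndFDerivAt <| by
    rw [minSmoothness_of_isRCLikeNormedField]
    exact WithTop.coe_le_coe.2 (le_top : (2 : ℕ∞) ≤ ⊤)
  have key : ∀ e : ℂ, fderiv ℝ (dW e g) ξ = ((1 / 2 : ℂ)) •
      ((fderiv ℝ (fderiv ℝ g) ξ).flip 1 + e • (fderiv ℝ (fderiv ℝ g) ξ).flip Complex.I) := by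
    intro e
    have hx : ∀ x : ℂ, HasFDerivAt (fun ζ => fderiv ℝ g ζ x)
        ((fderiv ℝ (fderiv ℝ g) ξ).flip x) ξ := fun x => by
      simpa using h1.hasFDerivAt.clm_apply (hasFDerivAt_const x ξ)
    exact (((hx 1).add ((hx Complex.I).const_mul e)).const_mul (1 / 2)).fderiv
  have e1 := hs.eq 1 Complex.I
  unfold dW at *
  simp only [key] at *
  simp [e1]
  ring

end Scalar

section Vector

variable {m n k : Type*} {c : ℂ} {ξ : ℂ}

lemma SmM.dW {M : ℂ → Matrix m n ℂ} (hM : SmM M ξ) (c : ℂ) : SmM (dWM c M) ξ :=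
  fun i j => smooth_dW c (hM i j)

lemma SmV.dW {v : ℂ → m → ℂ} (hv : SmV v ξ) (c : ℂ) : SmV (dWV c v) ξ :=
  fun i => smooth_dW c (hv i)

lemma SmM.add {A B : ℂ → Matrix m n ℂ} (hA : SmM A ξ) (hB : SmM B ξ) :
    SmM (fun ζ => A ζ + B ζ) ξ := fun i j => (hA i j).add (hB i j)

lemma SmM.sub {A B : ℂ → Matrix m n ℂ} (hA : SmM A ξ) (hB : SmM B ξ) :
    SmM (fun ζ => A ζ - B ζ) ξ := fun i j => (hA i j).sub (hB i j)

lemma SmM.neg {A : ℂ → Matrix m n ℂ} (hA : SmM A ξ) :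
    SmM (fun ζ => -A ζ) ξ := fun i j => (hA i j).neg

lemma SmM.const (A : Matrix m n ℂ) : SmM (fun _ => A) ξ := fun _ _ => contDiffAt_const

lemma SmM.smul {a : ℂ → ℂ} {A : ℂ → Matrix m n ℂ} (ha : ContDiffAt ℝ ∞ a ξ) (hA : SmM A ξ) :
    SmM (fun ζ => a ζ • A ζ) ξ := fun i j => ha.mul (hA i j)

lemma SmM.const_smul {A : ℂ → Matrix m n ℂ} (hA : SmM A ξ) (a : ℂ) :
    SmM (fun ζ => a • A ζ) ξ := SmM.smul contDiffAt_const hA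

lemma SmM.mul [Fintype n] {A : ℂ → Matrix m n ℂ} {B : ℂ → Matrix n k ℂ} (hA : SmM A ξ)
    (hB : SmM B ξ) : SmM (fun ζ => A ζ * B ζ) ξ := fun i j => by
  simp only [Matrix.mul_apply]
  exact ContDiffAt.sum fun l _ => (hA i l).mul (hB l j)

lemma SmM.comm [Fintype n] {A B : ℂ → Matrix n n ℂ} (hA : SmM A ξ)
    (hB : SmM B ξ) : SmM (fun ζ => CPN.comm (A ζ) (B ζ)) ξ := (hA.mul hB).sub (hB.mul hA)

lemma SmM.trace [Fintype n] {A : ℂ → Matrix n n ℂ} (hA : SmM A ξ) :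
    ContDiffAt ℝ ∞ (fun ζ => (A ζ).trace) ξ := by
  simp only [Matrix.trace]
  exact ContDiffAt.sum fun l _ => hA l l

lemma SmM.ip {N : ℕ} {A B : ℂ → Mat N} (hA : SmM A ξ) (hB : SmM B ξ) :
    ContDiffAt ℝ ∞ (fun ζ => ip (A ζ) (B ζ)) ξ := (hA.mul hB).trace.neg

lemma SmV.dotProduct [Fintype n] {v w : ℂ → n → ℂ} (hv : SmV v ξ) (hw : SmV w ξ) :
    ContDiffAt ℝ ∞ (fun ζ => v ζ ⬝ᵥ w ζ) ξ := by
  simp only [_root_.dotProduct]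
  exact ContDiffAt.sum fun l _ => (hv l).mul (hw l)

lemma SmV.vecMulVec {v : ℂ → m → ℂ} {w : ℂ → n → ℂ} (hv : SmV v ξ) (hw : SmV w ξ) :
    SmM (fun ζ => Matrix.vecMulVec (v ζ) (w ζ)) ξ := fun i j => (hv i).mul (hw j)

lemma dWM_congr (c : ℂ) {A B : ℂ → Matrix m n ℂ} (h : A =ᶠ[nhds ξ] B) :
    dWM c A ξ = dWM c B ξ := by
  ext i j
  exact dW_congr c (h.mono fun ζ hζ => by simp only [hζ])

lemma dWV_congr (c : ℂ) {v w : ℂ → m → ℂ} (h : v =ᶠ[nhds ξ] w) :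
    dWV c v ξ = dWV c w ξ := by
  ext i
  exact dW_congr c (h.mono fun ζ hζ => by simp only [hζ])

lemma dWM_const (c : ℂ) (A : Matrix m n ℂ) : dWM c (fun _ => A) ξ = 0 := by
  ext i j; simp [dWM, dW_const]

lemma dWM_sub (c : ℂ) {A B : ℂ → Matrix m n ℂ} (hA : SmM A ξ) (hB : SmM B ξ) :
    dWM c (fun ζ => A ζ - B ζ) ξ = dWM c A ξ - dWM c B ξ := by
  ext i j; exact dW_sub c (diffAt (hA i j)) (diffAt (hB i j))

lemma dWM_neg (c : ℂ) {A : ℂ → Matrix m n ℂ} :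
    dWM c (fun ζ => -A ζ) ξ = -dWM c A ξ := by
  ext i j; exact dW_neg c

lemma dWM_smul (c : ℂ) {a : ℂ → ℂ} {A : ℂ → Matrix m n ℂ} (ha : ContDiffAt ℝ ∞ a ξ)
    (hA : SmM A ξ) : dWM c (fun ζ => a ζ • A ζ) ξ = dW c a ξ • A ξ + a ξ • dWM c A ξ := by
  ext i j; exact dW_mul c (diffAt ha) (diffAt (hA i j))

lemma dWM_const_smul (c a : ℂ) {A : ℂ → Matrix m n ℂ}
    (hA : SmM A ξ) : dWM c (fun ζ => a • A ζ) ξ = a • dWM c A ξ := by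
  rw [dWM_smul c contDiffAt_const hA, dW_const, zero_smul, zero_add]

lemma dWM_sum {ι : Type*} (c : ℂ) (s : Finset ι) {A : ι → ℂ → Matrix m n ℂ}
    (hA : ∀ l ∈ s, SmM (A l) ξ) :
    dWM c (fun ζ => ∑ l ∈ s, A l ζ) ξ = ∑ l ∈ s, dWM c (A l) ξ := by
  ext i j
  simp only [dWM, Matrix.of_apply, Matrix.sum_apply]
  exact dW_sum c s _ fun l hl => diffAt (hA l hl i j)

lemma dWM_conjTranspose (c : ℂ) (A : ℂ → Matrix m n ℂ) :
    dWM c (fun ζ => (A ζ)ᴴ) ξ = (dWM (star c) A ξ)ᴴ := by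
  ext i j; exact dW_star c _ ξ

lemma dWV_star (c : ℂ) (v : ℂ → m → ℂ) :
    dWV c (fun ζ => star (v ζ)) ξ = star (dWV (star c) v ξ) := by
  ext i; exact dW_star c _ ξ

lemma dWM_mul [Fintype n] (c : ℂ) {A : ℂ → Matrix m n ℂ} {B : ℂ → Matrix n k ℂ} (hA : SmM A ξ)
    (hB : SmM B ξ) : dWM c (fun ζ => A ζ * B ζ) ξ = dWM c A ξ * B ξ + A ξ * dWM c B ξ := by
  ext i j
  simp only [dWM, Matrix.of_apply, Matrix.mul_apply, Matrix.add_apply]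
  rw [dW_sum c _ _ fun l _ => (diffAt (hA i l)).fun_mul (diffAt (hB l j)),
    ← Finset.sum_add_distrib]
  exact Finset.sum_congr rfl fun l _ => dW_mul c (diffAt (hA i l)) (diffAt (hB l j))

lemma dWM_commutator [Fintype n] (c : ℂ) {A B : ℂ → Matrix n n ℂ} (hA : SmM A ξ)
    (hB : SmM B ξ) :
    dWM c (fun ζ => comm (A ζ) (B ζ)) ξ = comm (dWM c A ξ) (B ξ) + comm (A ξ) (dWM c B ξ) := by
  unfold comm
  rw [dWM_sub c (hA.mul hB) (hB.mul hA), dWM_mul c hA hB, dWM_mul c hB hA]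
  abel

lemma dW_dotProduct [Fintype n] (c : ℂ) {v w : ℂ → n → ℂ} (hv : SmV v ξ) (hw : SmV w ξ) :
    dW c (fun ζ => v ζ ⬝ᵥ w ζ) ξ = dWV c v ξ ⬝ᵥ w ξ + v ξ ⬝ᵥ dWV c w ξ := by
  simp only [dWV, dotProduct]
  rw [dW_sum c _ _ fun l _ => (diffAt (hv l)).fun_mul (diffAt (hw l)), ← Finset.sum_add_distrib]
  exact Finset.sum_congr rfl fun l _ => dW_mul c (diffAt (hv l)) (diffAt (hw l))

lemma dWM_vecMulVec (c : ℂ) {v : ℂ → m → ℂ} {w : ℂ → n → ℂ} (hv : SmV v ξ) (hw : SmV w ξ) :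
    dWM c (fun ζ => Matrix.vecMulVec (v ζ) (w ζ)) ξ =
      Matrix.vecMulVec (dWV c v ξ) (w ξ) + Matrix.vecMulVec (v ξ) (dWV c w ξ) := by
  ext i j; exact dW_mul c (diffAt (hv i)) (diffAt (hw j))

lemma dWV_mulVec [Fintype n] (c : ℂ) {A : ℂ → Matrix m n ℂ} {v : ℂ → n → ℂ} (hA : SmM A ξ)
    (hv : SmV v ξ) :
    dWV c (fun ζ => A ζ *ᵥ v ζ) ξ = dWM c A ξ *ᵥ v ξ + A ξ *ᵥ dWV c v ξ := by
  ext i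
  simp only [dWM, dWV, Matrix.mulVec, dotProduct, Matrix.of_apply, Pi.add_apply]
  rw [dW_sum c _ _ fun l _ => (diffAt (hA i l)).fun_mul (diffAt (hv l)),
    ← Finset.sum_add_distrib]
  exact Finset.sum_congr rfl fun l _ => dW_mul c (diffAt (hA i l)) (diffAt (hv l))

lemma dWV_vecMul [Fintype m] (c : ℂ) {A : ℂ → Matrix m n ℂ} {v : ℂ → m → ℂ} (hA : SmM A ξ)
    (hv : SmV v ξ) :
    dWV c (fun ζ => v ζ ᵥ* A ζ) ξ = dWV c v ξ ᵥ* A ξ + v ξ ᵥ* dWM c A ξ := by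
  ext i
  simp only [dWM, dWV, Matrix.vecMul, dotProduct, Matrix.of_apply, Pi.add_apply]
  rw [dW_sum c _ _ fun l _ => (diffAt (hv l)).fun_mul (diffAt (hA l i)),
    ← Finset.sum_add_distrib]
  exact Finset.sum_congr rfl fun l _ => dW_mul c (diffAt (hv l)) (diffAt (hA l i))

lemma dW_trace [Fintype n] (c : ℂ) {A : ℂ → Matrix n n ℂ} (hA : SmM A ξ) :
    dW c (fun ζ => (A ζ).trace) ξ = (dWM c A ξ).trace := by
  simp only [Matrix.trace]
  exact dW_sum c _ _ fun l _ => diffAt (hA l l)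

lemma dW_ip {N : ℕ} (c : ℂ) {A B : ℂ → Mat N} (hA : SmM A ξ) (hB : SmM B ξ) :
    dW c (fun ζ => ip (A ζ) (B ζ)) ξ = ip (dWM c A ξ) (B ξ) + ip (A ξ) (dWM c B ξ) := by
  unfold ip
  rw [dW_neg, dW_trace c (hA.mul hB), dWM_mul c hA hB, Matrix.trace_add]
  ring

lemma dWM_comm (c d : ℂ) {A : ℂ → Matrix m n ℂ} (hA : SmM A ξ) :
    dWM c (dWM d A) ξ = dWM d (dWM c A) ξ := by
  ext i j; exact dW_comm c d (hA i j)

end Vector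

/-- `f` is a smooth nowhere vanishing field on the open set `U`. -/
structure Regular {N : ℕ} (f : ℂ → Fin (N + 1) → ℂ) (U : Set ℂ) : Prop where
  isOpen : IsOpen U
  smooth : ∀ ξ ∈ U, SmV f ξ
  ne_zero : ∀ ξ ∈ U, f ξ ≠ 0

/-! ### The projector `P`. -/

section Algebra

variable {N : ℕ} {f : ℂ → Fin (N + 1) → ℂ} {ξ : ℂ}

lemma nf_star (f : ℂ → Fin (N + 1) → ℂ) (ξ : ℂ) : star (nf f ξ) = nf f ξ := by
  simp [nf, fd, dotProduct, star_sum, mul_comm]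

open scoped ComplexOrder in
lemma nf_ne (h : f ξ ≠ 0) : nf f ξ ≠ 0 := by
  rw [nf, fd]
  exact mt dotProduct_star_self_eq_zero.1 h

lemma P_mulVec (f : ℂ → Fin (N + 1) → ℂ) (ξ : ℂ) (x : Fin (N + 1) → ℂ) :
    P f ξ *ᵥ x = x - ((nf f ξ)⁻¹ * (fd f ξ ⬝ᵥ x)) • f ξ := by
  simp only [P, Matrix.sub_mulVec, Matrix.one_mulVec, Matrix.smul_mulVec, Matrix.vecMulVec_mulVec]
  ext i; simp; ring

lemma vecMul_P (f : ℂ → Fin (N + 1) → ℂ) (ξ : ℂ) (x : Fin (N + 1) → ℂ) :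
    x ᵥ* P f ξ = x - ((nf f ξ)⁻¹ * (x ⬝ᵥ f ξ)) • fd f ξ := by
  simp only [P, Matrix.vecMul_sub, Matrix.vecMul_one, Matrix.vecMul_smul, Matrix.vecMul_vecMulVec]
  ext i; simp; ring

lemma P_mulVec_self (h : f ξ ≠ 0) : P f ξ *ᵥ f ξ = 0 := by
  rw [P_mulVec, ← nf, inv_mul_cancel₀ (nf_ne h), one_smul, sub_self]

lemma fd_vecMul_P (h : f ξ ≠ 0) : fd f ξ ᵥ* P f ξ = 0 := by
  rw [vecMul_P, ← nf, inv_mul_cancel₀ (nf_ne h), one_smul, sub_self]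

lemma P_conjTranspose (f : ℂ → Fin (N + 1) → ℂ) (ξ : ℂ) : (P f ξ)ᴴ = P f ξ := by
  have h := nf_star f ξ
  ext i j
  simp only [P, Matrix.conjTranspose_sub, Matrix.conjTranspose_one, Matrix.conjTranspose_smul,
    Matrix.conjTranspose_vecMulVec, star_inv₀, h, fd, star_star]

lemma P_mul_P (h : f ξ ≠ 0) : P f ξ * P f ξ = P f ξ := by
  conv_lhs => lhs; rw [P]
  rw [sub_mul, one_mul, Matrix.smul_mul, Matrix.vecMulVec_mul, fd_vecMul_P h]
  simp

lemma P_mulVec_P (h : f ξ ≠ 0) (x : Fin (N + 1) → ℂ) :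
    P f ξ *ᵥ (P f ξ *ᵥ x) = P f ξ *ᵥ x := by
  rw [Matrix.mulVec_mulVec, P_mul_P h]

lemma vecMul_P_P (h : f ξ ≠ 0) (x : Fin (N + 1) → ℂ) :
    (x ᵥ* P f ξ) ᵥ* P f ξ = x ᵥ* P f ξ := by
  rw [Matrix.vecMul_vecMul, P_mul_P h]

lemma fd_dot_P (h : f ξ ≠ 0) (x : Fin (N + 1) → ℂ) : fd f ξ ⬝ᵥ (P f ξ *ᵥ x) = 0 := by
  rw [Matrix.dotProduct_mulVec, fd_vecMul_P h, zero_dotProduct]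

lemma P_dot_self (h : f ξ ≠ 0) (x : Fin (N + 1) → ℂ) : (x ᵥ* P f ξ) ⬝ᵥ f ξ = 0 := by
  rw [← Matrix.dotProduct_mulVec, P_mulVec_self h, dotProduct_zero]

lemma star_P_mulVec (x : Fin (N + 1) → ℂ) : star (P f ξ *ᵥ x) = star x ᵥ* P f ξ := by
  rw [Matrix.star_mulVec, P_conjTranspose]

lemma star_vecMul_P (x : Fin (N + 1) → ℂ) : star (x ᵥ* P f ξ) = P f ξ *ᵥ star x := by
  rw [Matrix.star_vecMul, P_conjTranspose]

end Algebra

/-! ### Derivatives of `P` and the traces built from them. -/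

section Derivatives

variable {N : ℕ} {f : ℂ → Fin (N + 1) → ℂ} {U : Set ℂ} {ξ : ℂ}

lemma Regular.eventually (R : Regular f U) (hξ : ξ ∈ U) {p : ℂ → Prop} (h : ∀ ζ ∈ U, p ζ) :
    ∀ᶠ ζ in nhds ξ, p ζ := Filter.Eventually.mono (R.isOpen.mem_nhds hξ) h

lemma SmV.fd (hf : SmV f ξ) : SmV (fd f) ξ := fun i => smooth_star (hf i)

lemma SmV.nf (hf : SmV f ξ) : ContDiffAt ℝ ∞ (nf f) ξ := hf.fd.dotProduct hf

lemma Regular.smP (R : Regular f U) (hξ : ξ ∈ U) : SmM (P f) ξ := by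
  have hf := R.smooth ξ hξ
  exact (SmM.const 1).sub (SmM.smul (hf.nf.inv (nf_ne (R.ne_zero ξ hξ))) (hf.vecMulVec hf.fd))

lemma Regular.sm_inv_nf (R : Regular f U) (hξ : ξ ∈ U) :
    ContDiffAt ℝ ∞ (fun ζ => (nf f ζ)⁻¹) ξ :=
  (R.smooth ξ hξ).nf.inv (nf_ne (R.ne_zero ξ hξ))

lemma Regular.dW_inv_nf (R : Regular f U) (hξ : ξ ∈ U) (c : ℂ) :
    dW c (fun ζ => (nf f ζ)⁻¹) ξ =
      -(nf f ξ)⁻¹ ^ 2 * (dWV c (fd f) ξ ⬝ᵥ f ξ + fd f ξ ⬝ᵥ dWV c f ξ) := by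
  have hf := R.smooth ξ hξ
  have hn := nf_ne (R.ne_zero ξ hξ)
  have h1 : dW c (fun ζ => (nf f ζ)⁻¹ * nf f ζ) ξ = 0 := by
    rw [← dW_const (ξ := ξ) c 1]
    exact dW_congr c (R.eventually hξ fun ζ hζ => inv_mul_cancel₀ (nf_ne (R.ne_zero ζ hζ)))
  rw [dW_mul c (diffAt (R.sm_inv_nf hξ)) (diffAt hf.nf)] at h1
  have h2 : dW c (nf f) ξ = _ := dW_dotProduct c hf.fd hf
  rw [h2] at h1
  field_simp at h1 ⊢
  linear_combination h1

/-- The derivative of a projector has only off-diagonal blocks: the contribution of `(f†f)⁻¹`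
removes exactly the components of the derivatives of `f` and `f†` along `f` and `f†`. -/
lemma Regular.dP (R : Regular f U) (hξ : ξ ∈ U) (c : ℂ) :
    dWM c (P f) ξ = -((nf f ξ)⁻¹ • (Matrix.vecMulVec (P f ξ *ᵥ dWV c f ξ) (fd f ξ) +
      Matrix.vecMulVec (f ξ) (dWV c (fd f) ξ ᵥ* P f ξ))) := by
  have hf := R.smooth ξ hξ
  have h1 : dWM c (P f) ξ = dWM c (fun _ => 1) ξ - dWM c (fun ζ => (nf f ζ)⁻¹ •
      Matrix.vecMulVec (f ζ) (fd f ζ)) ξ :=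
    dWM_sub c (SmM.const 1) (SmM.smul (R.sm_inv_nf hξ) (hf.vecMulVec hf.fd))
  rw [h1, dWM_const, dWM_smul c (R.sm_inv_nf hξ) (hf.vecMulVec hf.fd), dWM_vecMulVec c hf hf.fd,
    R.dW_inv_nf hξ, P_mulVec, vecMul_P]
  ext i j
  simp only [Matrix.sub_apply, Matrix.zero_apply, Matrix.add_apply, Matrix.smul_apply,
    Matrix.neg_apply, Matrix.vecMulVec_apply, Pi.sub_apply, Pi.smul_apply, smul_eq_mul]
  ring

/-- The commutator `[∂P, P]` for the derivative `dW c`. -/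
def G (f : ℂ → Fin (N + 1) → ℂ) (c : ℂ) (ξ : ℂ) : Mat N := comm (dWM c (P f) ξ) (P f ξ)

lemma Regular.smG (R : Regular f U) (hξ : ξ ∈ U) (c : ℂ) : SmM (G f c) ξ :=
  ((R.smP hξ).dW c).comm (R.smP hξ)

lemma Regular.G_eq (R : Regular f U) (hξ : ξ ∈ U) (c : ℂ) :
    G f c ξ = (nf f ξ)⁻¹ • (Matrix.vecMulVec (P f ξ *ᵥ dWV c f ξ) (fd f ξ) -
      Matrix.vecMulVec (f ξ) (dWV c (fd f) ξ ᵥ* P f ξ)) := by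
  have h0 := R.ne_zero ξ hξ
  rw [G, comm, R.dP hξ]
  simp only [neg_mul, mul_neg, Matrix.smul_mul, Matrix.mul_smul, add_mul, mul_add,
    Matrix.vecMulVec_mul, Matrix.mul_vecMulVec, fd_vecMul_P h0, P_mulVec_self h0, P_mulVec_P h0,
    vecMul_P_P h0, Matrix.vecMulVec_zero, Matrix.zero_vecMulVec]
  module

lemma P_dW_conjTranspose (c : ℂ) : (dWM c (P f) ξ)ᴴ = dWM (star c) (P f) ξ := by
  have h := dWM_conjTranspose (ξ := ξ) (star c) (P f)
  simp only [P_conjTranspose, star_star] at h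
  exact h.symm

lemma G_conjTranspose (c : ℂ) : (G f c ξ)ᴴ = -G f (star c) ξ := by
  simp only [G, comm, Matrix.conjTranspose_sub, Matrix.conjTranspose_mul, P_conjTranspose,
    P_dW_conjTranspose]
  abel

lemma T₁_eq : T₁ f = fun ξ => -Complex.I • G f (-Complex.I) ξ := by
  funext ξ
  have h : K f ξ = G f Complex.I ξ := rfl
  rw [T₁, h, G_conjTranspose]
  simp

lemma T₂_eq : T₂ f = fun ξ => Complex.I • G f Complex.I ξ := rfl

lemma T₁_conjTranspose : (T₁ f ξ)ᴴ = -T₂ f ξ := by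
  rw [T₁_eq, T₂_eq]
  simp [G_conjTranspose]

lemma Regular.G_mulVec (R : Regular f U) (hξ : ξ ∈ U) (c : ℂ) (x : Fin (N + 1) → ℂ) :
    G f c ξ *ᵥ x = (nf f ξ)⁻¹ • ((fd f ξ ⬝ᵥ x) • (P f ξ *ᵥ dWV c f ξ) -
      ((dWV c (fd f) ξ ᵥ* P f ξ) ⬝ᵥ x) • f ξ) := by
  rw [R.G_eq hξ]
  simp [Matrix.smul_mulVec, Matrix.sub_mulVec, Matrix.vecMulVec_mulVec]

lemma Regular.vecMul_G (R : Regular f U) (hξ : ξ ∈ U) (c : ℂ) (x : Fin (N + 1) → ℂ) :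
    x ᵥ* G f c ξ = (nf f ξ)⁻¹ • ((x ⬝ᵥ (P f ξ *ᵥ dWV c f ξ)) • fd f ξ -
      (x ⬝ᵥ f ξ) • (dWV c (fd f) ξ ᵥ* P f ξ)) := by
  rw [R.G_eq hξ]
  simp [Matrix.vecMul_smul, Matrix.vecMul_sub, Matrix.vecMul_vecMulVec]

lemma Regular.dP_mulVec (R : Regular f U) (hξ : ξ ∈ U) (c : ℂ) (x : Fin (N + 1) → ℂ) :
    dWM c (P f) ξ *ᵥ x = -((nf f ξ)⁻¹ • ((fd f ξ ⬝ᵥ x) • (P f ξ *ᵥ dWV c f ξ) +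
      ((dWV c (fd f) ξ ᵥ* P f ξ) ⬝ᵥ x) • f ξ)) := by
  rw [R.dP hξ]
  simp [Matrix.neg_mulVec, Matrix.smul_mulVec, Matrix.add_mulVec, Matrix.vecMulVec_mulVec]

lemma Regular.vecMul_dP (R : Regular f U) (hξ : ξ ∈ U) (c : ℂ) (x : Fin (N + 1) → ℂ) :
    x ᵥ* dWM c (P f) ξ = -((nf f ξ)⁻¹ • ((x ⬝ᵥ (P f ξ *ᵥ dWV c f ξ)) • fd f ξ +
      (x ⬝ᵥ f ξ) • (dWV c (fd f) ξ ᵥ* P f ξ))) := by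
  rw [R.dP hξ]
  simp [Matrix.vecMul_neg, Matrix.vecMul_smul, Matrix.vecMul_add, Matrix.vecMul_vecMulVec]

lemma Regular.G_mulVec_self (R : Regular f U) (hξ : ξ ∈ U) (c : ℂ) :
    G f c ξ *ᵥ f ξ = P f ξ *ᵥ dWV c f ξ := by
  have h0 := R.ne_zero ξ hξ
  rw [R.G_mulVec hξ, P_dot_self h0, zero_smul, sub_zero, smul_smul, ← nf,
    inv_mul_cancel₀ (nf_ne h0), one_smul]

lemma Regular.fd_vecMul_G (R : Regular f U) (hξ : ξ ∈ U) (c : ℂ) :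
    fd f ξ ᵥ* G f c ξ = -(dWV c (fd f) ξ ᵥ* P f ξ) := by
  have h0 := R.ne_zero ξ hξ
  rw [R.vecMul_G hξ, fd_dot_P h0, zero_smul, zero_sub, smul_neg, smul_smul, ← nf,
    inv_mul_cancel₀ (nf_ne h0), one_smul]

/-- `G` is off-diagonal, so only the blocks `f†XP` and `PXf` of `X` enter the trace. -/
lemma Regular.trace_mul_G (R : Regular f U) (hξ : ξ ∈ U) (c : ℂ) (X : Mat N) :
    (X * G f c ξ).trace = (nf f ξ)⁻¹ * (((fd f ξ ᵥ* X) ᵥ* P f ξ) ⬝ᵥ dWV c f ξ -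
      dWV c (fd f) ξ ⬝ᵥ (P f ξ *ᵥ (X *ᵥ f ξ))) := by
  rw [R.G_eq hξ]
  simp only [Matrix.mul_smul, mul_sub, Matrix.mul_vecMulVec, Matrix.trace_smul, Matrix.trace_sub,
    Matrix.trace_vecMulVec, smul_eq_mul]
  rw [dotProduct_comm (X *ᵥ _), dotProduct_comm (X *ᵥ _), Matrix.dotProduct_mulVec,
    Matrix.dotProduct_mulVec, Matrix.dotProduct_mulVec (dWV c (fd f) ξ),
    Matrix.dotProduct_mulVec (_ ᵥ* _)]

/-- The column `P ∂∂'f - (f†f)⁻¹ ((f†∂f) P∂'f + (f†∂'f) P∂f)` for `∂ = dW c`, `∂' = dW d`. -/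
lemma Regular.P_dG_mulVec_self (R : Regular f U) (hξ : ξ ∈ U) (c d : ℂ) :
    P f ξ *ᵥ (dWM d (G f c) ξ *ᵥ f ξ) = P f ξ *ᵥ (dWV d (dWV c f) ξ - (nf f ξ)⁻¹ •
      ((fd f ξ ⬝ᵥ dWV c f ξ) • dWV d f ξ + (fd f ξ ⬝ᵥ dWV d f ξ) • dWV c f ξ)) := by
  have h0 := R.ne_zero ξ hξ
  have hf := R.smooth ξ hξ
  -- Differentiating the relation `G f = P ∂f` avoids expanding the derivative of `G` itself.
  have h1 : dWV d (fun ζ => G f c ζ *ᵥ f ζ) ξ = dWV d (fun ζ => P f ζ *ᵥ dWV c f ζ) ξ :=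
    dWV_congr d (R.eventually hξ fun ζ hζ => R.G_mulVec_self hζ c)
  rw [dWV_mulVec d (R.smG hξ c) hf, dWV_mulVec d (R.smP hξ) (hf.dW c)] at h1
  rw [eq_sub_of_add_eq h1, R.dP_mulVec hξ, R.G_mulVec hξ]
  simp only [Matrix.mulVec_sub, Matrix.mulVec_add, Matrix.mulVec_neg, Matrix.mulVec_smul,
    P_mulVec_P h0, P_mulVec_self h0, smul_zero, add_zero, sub_zero]
  module

lemma Regular.fd_vecMul_dG_P (R : Regular f U) (hξ : ξ ∈ U) (c d : ℂ) :
    (fd f ξ ᵥ* dWM d (G f c) ξ) ᵥ* P f ξ = -((dWV d (dWV c (fd f)) ξ - (nf f ξ)⁻¹ •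
      ((dWV c (fd f) ξ ⬝ᵥ f ξ) • dWV d (fd f) ξ + (dWV d (fd f) ξ ⬝ᵥ f ξ) • dWV c (fd f) ξ))
      ᵥ* P f ξ) := by
  have h0 := R.ne_zero ξ hξ
  have hf := (R.smooth ξ hξ).fd
  have h1 : dWV d (fun ζ => fd f ζ ᵥ* G f c ζ) ξ = dWV d (fun ζ => dWV c (fd f) ζ ᵥ* (-P f ζ)) ξ :=
    dWV_congr d (R.eventually hξ fun ζ hζ => by
      simpa [Matrix.vecMul_neg] using R.fd_vecMul_G hζ c)
  rw [dWV_vecMul d (R.smG hξ c) hf, dWV_vecMul d (R.smP hξ).neg (hf.dW c), dWM_neg] at h1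
  rw [eq_sub_of_add_eq' h1, Matrix.vecMul_neg, Matrix.vecMul_neg, R.vecMul_dP hξ, R.vecMul_G hξ]
  simp only [Matrix.sub_vecMul, Matrix.add_vecMul, Matrix.neg_vecMul, Matrix.smul_vecMul,
    vecMul_P_P h0, fd_vecMul_P h0, smul_zero, zero_add, zero_sub]
  module

lemma Regular.trace_G_mul_G (R : Regular f U) (hξ : ξ ∈ U) (c e : ℂ) :
    (G f c ξ * G f e ξ).trace = -((nf f ξ)⁻¹ * (sw f ξ (dWV c (fd f) ξ) (dWV e f ξ) +
      sw f ξ (dWV e (fd f) ξ) (dWV c f ξ))) := by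
  have h0 := R.ne_zero ξ hξ
  rw [R.trace_mul_G hξ, R.fd_vecMul_G hξ, R.G_mulVec_self hξ, Matrix.neg_vecMul, vecMul_P_P h0,
    P_mulVec_P h0, neg_dotProduct, ← Matrix.dotProduct_mulVec]
  simp only [sw]
  ring

/-- With `c = d = -i` this supplies the numerators of `a₁₁` and `a₁₂`. -/
lemma Regular.trace_dG_mul_G (R : Regular f U) (hξ : ξ ∈ U) (c d e : ℂ) :
    (dWM d (G f c) ξ * G f e ξ).trace = -((nf f ξ)⁻¹ *
      (sw f ξ (dWV d (dWV c (fd f)) ξ) (dWV e f ξ) + sw f ξ (dWV e (fd f) ξ) (dWV d (dWV c f) ξ) -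
        (nf f ξ)⁻¹ * ((dWV c (fd f) ξ ⬝ᵥ f ξ) * sw f ξ (dWV d (fd f) ξ) (dWV e f ξ) +
          (dWV d (fd f) ξ ⬝ᵥ f ξ) * sw f ξ (dWV c (fd f) ξ) (dWV e f ξ) +
          (fd f ξ ⬝ᵥ dWV c f ξ) * sw f ξ (dWV e (fd f) ξ) (dWV d f ξ) +
          (fd f ξ ⬝ᵥ dWV d f ξ) * sw f ξ (dWV e (fd f) ξ) (dWV c f ξ)))) := by
  rw [R.trace_mul_G hξ, R.fd_vecMul_dG_P hξ, R.P_dG_mulVec_self hξ, neg_dotProduct,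
    ← Matrix.dotProduct_mulVec]
  simp only [sw, Matrix.mulVec_sub, Matrix.mulVec_add, Matrix.mulVec_smul, sub_dotProduct,
    add_dotProduct, smul_dotProduct, dotProduct_sub, dotProduct_add, dotProduct_smul, smul_eq_mul]
  ring

end Derivatives

/-! ### Commutators and the trace form. -/

section Commutator

variable {m : Type*} [Fintype m]

lemma comm_conjTranspose (A B : Matrix m m ℂ) : (comm A B)ᴴ = -comm Aᴴ Bᴴ := by
  simp only [comm, Matrix.conjTranspose_sub, Matrix.conjTranspose_mul]; abel

lemma trace_comm (A B : Matrix m m ℂ) : (comm A B).trace = 0 := by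
  rw [comm, Matrix.trace_sub, Matrix.trace_mul_comm, sub_self]

/-- Both terms of the commutator become `QAQ`. This is why `Z ↦ PZP` annihilates `T₁`, `T₂` and `W`.
-/
lemma sandwich_comm {Q : Matrix m m ℂ} (hQ : Q * Q = Q) (A : Matrix m m ℂ) :
    Q * comm A Q * Q = 0 := by
  rw [comm, mul_sub, sub_mul, ← mul_assoc, ← mul_assoc, mul_assoc (Q * A), hQ, sub_self]

lemma comm_swap (A B : Matrix m m ℂ) : comm A B = -comm B A := by simp [comm]

end Commutator

section Bilinear

variable {N : ℕ} (X Y Z : Mat N) (a : ℂ)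

lemma ip_comm : ip X Y = ip Y X := by rw [ip, ip, Matrix.trace_mul_comm]

lemma ip_add_left : ip (X + Y) Z = ip X Z + ip Y Z := by
  simp only [ip, add_mul, Matrix.trace_add]; ring

lemma ip_sub_left : ip (X - Y) Z = ip X Z - ip Y Z := by
  simp only [ip, sub_mul, Matrix.trace_sub]; ring

lemma ip_neg_left : ip (-X) Y = -ip X Y := by simp [ip]

lemma ip_neg_right : ip X (-Y) = -ip X Y := by simp [ip]

lemma ip_smul_left : ip (a • X) Y = a * ip X Y := by simp [ip]

lemma ip_smul_right : ip X (a • Y) = a * ip X Y := by simp [ip]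

lemma ip_zero_left : ip 0 X = 0 := by simp [ip]

lemma ip_sum_left {ι : Type*} (s : Finset ι) (F : ι → Mat N) :
    ip (∑ i ∈ s, F i) X = ∑ i ∈ s, ip (F i) X := by
  simp only [ip, Finset.sum_mul, Matrix.trace_sum, Finset.sum_neg_distrib]

lemma star_ip : star (ip X Y) = ip Xᴴ Yᴴ := by
  rw [ip, ip, star_neg, ← Matrix.trace_conjTranspose, Matrix.conjTranspose_mul,
    Matrix.trace_mul_comm]

end Bilinear

/-! ### The tangent fields, their derivatives and the induced metric. -/

section Tangent

variable {N : ℕ} {f : ℂ → Fin (N + 1) → ℂ} {U : Set ℂ} {ξ : ℂ}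

lemma Regular.smT₁ (R : Regular f U) (hξ : ξ ∈ U) : SmM (T₁ f) ξ := by
  rw [T₁_eq]; exact (R.smG hξ _).const_smul _

lemma Regular.smT₂ (R : Regular f U) (hξ : ξ ∈ U) : SmM (T₂ f) ξ := by
  rw [T₂_eq]; exact (R.smG hξ _).const_smul _

lemma Regular.smT₁₂ (R : Regular f U) (hξ : ξ ∈ U) : SmM (T₁₂ f) ξ := by
  unfold T₁₂
  rw [dzM_eq, dzbM_eq]
  exact ((((R.smP hξ).dW _).comm ((R.smP hξ).dW _)).const_smul _).neg

lemma T₂_conjTranspose : (T₂ f ξ)ᴴ = -T₁ f ξ := by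
  rw [← neg_eq_iff_eq_neg, ← Matrix.conjTranspose_neg, ← T₁_conjTranspose,
    Matrix.conjTranspose_conjTranspose]

lemma T₁₂_conjTranspose : (T₁₂ f ξ)ᴴ = -T₁₂ f ξ := by
  simp only [T₁₂, dzM_eq, dzbM_eq, Matrix.conjTranspose_neg, Matrix.conjTranspose_smul,
    comm_conjTranspose, P_dW_conjTranspose]
  rw [comm_swap]
  simp

lemma trace_T₁ : (T₁ f ξ).trace = 0 := by
  rw [T₁_eq, Matrix.trace_smul, G, trace_comm, smul_zero]

lemma trace_T₂ : (T₂ f ξ).trace = 0 := by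
  rw [T₂_eq, Matrix.trace_smul, G, trace_comm, smul_zero]

lemma trace_T₁₂ : (T₁₂ f ξ).trace = 0 := by
  rw [T₁₂, Matrix.trace_neg, Matrix.trace_smul, trace_comm, smul_zero, neg_zero]

lemma sandwich_T₁ (h : f ξ ≠ 0) : P f ξ * T₁ f ξ * P f ξ = 0 := by
  rw [T₁_eq, Matrix.mul_smul, Matrix.smul_mul, G, sandwich_comm (P_mul_P h), smul_zero]

lemma sandwich_T₂ (h : f ξ ≠ 0) : P f ξ * T₂ f ξ * P f ξ = 0 := by
  rw [T₂_eq, Matrix.mul_smul, Matrix.smul_mul, G, sandwich_comm (P_mul_P h), smul_zero]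

/-- The matrix `W = [∂∂̄P, P]`, which vanishes exactly where `f` satisfies the equations of the
sigma model. -/
def W (f : ℂ → Fin (N + 1) → ℂ) (ξ : ℂ) : Mat N :=
  comm (dWM (-Complex.I) (dWM Complex.I (P f)) ξ) (P f ξ)

lemma Regular.smW (R : Regular f U) (hξ : ξ ∈ U) : SmM (W f) ξ :=
  (((R.smP hξ).dW _).dW _).comm (R.smP hξ)

lemma sandwich_W (h : f ξ ≠ 0) : P f ξ * W f ξ * P f ξ = 0 := sandwich_comm (P_mul_P h) _

lemma Regular.W_conjTranspose (R : Regular f U) (hξ : ξ ∈ U) : (W f ξ)ᴴ = -W f ξ := by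
  have h1 := dWM_conjTranspose (ξ := ξ) Complex.I (dWM Complex.I (P f))
  simp only [P_dW_conjTranspose] at h1
  simp only [Complex.star_def, Complex.conj_I] at h1
  rw [W, comm_conjTranspose, P_conjTranspose, ← h1, dWM_comm _ _ (R.smP hξ)]

lemma Regular.dG_eq (R : Regular f U) (hξ : ξ ∈ U) (c d : ℂ) :
    dWM d (G f c) ξ = comm (dWM d (dWM c (P f)) ξ) (P f ξ) +
      comm (dWM c (P f) ξ) (dWM d (P f) ξ) :=
  dWM_commutator d ((R.smP hξ).dW c) (R.smP hξ)

/-- With the opposite sign of `W` in `Regular.dzbM_T₁`, this identifies `W` as the obstruction to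
closedness of the form. -/
lemma Regular.dzM_T₂ (R : Regular f U) (hξ : ξ ∈ U) :
    dzM (T₂ f) ξ = T₁₂ f ξ + Complex.I • W f ξ := by
  rw [T₂_eq, dzM_eq, dWM_const_smul _ _ (R.smG hξ _), R.dG_eq hξ, T₁₂, W, dzM_eq, dzbM_eq,
    comm_swap (dWM Complex.I (P f) ξ)]
  module

lemma Regular.dzbM_T₁ (R : Regular f U) (hξ : ξ ∈ U) :
    dzbM (T₁ f) ξ = T₁₂ f ξ - Complex.I • W f ξ := by
  rw [T₁_eq, dzbM_eq, dWM_const_smul _ _ (R.smG hξ _), R.dG_eq hξ, T₁₂, W, dzM_eq, dzbM_eq,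
    dWM_comm _ _ (R.smP hξ)]
  module

lemma Regular.dP_mulVec_self (R : Regular f U) (hξ : ξ ∈ U) (c : ℂ) :
    dWM c (P f) ξ *ᵥ f ξ = -(P f ξ *ᵥ dWV c f ξ) := by
  have h0 := R.ne_zero ξ hξ
  rw [R.dP_mulVec hξ, P_dot_self h0, zero_smul, add_zero, smul_smul, ← nf,
    inv_mul_cancel₀ (nf_ne h0), one_smul]

lemma Regular.fd_vecMul_dP (R : Regular f U) (hξ : ξ ∈ U) (c : ℂ) :
    fd f ξ ᵥ* dWM c (P f) ξ = -(dWV c (fd f) ξ ᵥ* P f ξ) := by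
  have h0 := R.ne_zero ξ hξ
  rw [R.vecMul_dP hξ, fd_dot_P h0, zero_smul, zero_add, smul_smul, ← nf,
    inv_mul_cancel₀ (nf_ne h0), one_smul]

/-- Each derivative of `P` exchanges the line of `f` and its complement, so a product of two of them
maps `f` back into its line. -/
lemma Regular.P_comm_dP_mulVec (R : Regular f U) (hξ : ξ ∈ U) (c d : ℂ) :
    P f ξ *ᵥ (comm (dWM c (P f) ξ) (dWM d (P f) ξ) *ᵥ f ξ) = 0 := by
  have h0 := R.ne_zero ξ hξ
  simp only [comm, Matrix.sub_mulVec, ← Matrix.mulVec_mulVec, R.dP_mulVec_self hξ]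
  simp only [Matrix.mulVec_neg, R.dP_mulVec hξ, dotProduct_neg, fd_dot_P h0, Matrix.mulVec_sub,
    Matrix.mulVec_smul,
    zero_smul, zero_add, P_mulVec_self h0, smul_zero, neg_zero, sub_zero]

lemma Regular.fd_comm_dP_P (R : Regular f U) (hξ : ξ ∈ U) (c d : ℂ) :
    (fd f ξ ᵥ* comm (dWM c (P f) ξ) (dWM d (P f) ξ)) ᵥ* P f ξ = 0 := by
  have h0 := R.ne_zero ξ hξ
  simp only [comm, Matrix.vecMul_sub, ← Matrix.vecMul_vecMul, R.fd_vecMul_dP hξ]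
  simp only [Matrix.neg_vecMul, R.vecMul_dP hξ, neg_dotProduct, P_dot_self h0, Matrix.sub_vecMul,
    Matrix.smul_vecMul, zero_smul, add_zero, fd_vecMul_P h0, smul_zero, neg_zero, sub_zero]

/-- Block diagonal matrices are trace-orthogonal to off-diagonal ones. Equation (1) plays no role,
so the zeros in the tangential blocks of `A` and `B` are correct for every `f`. -/
lemma Regular.ip_T₁₂_G (R : Regular f U) (hξ : ξ ∈ U) (c : ℂ) : ip (T₁₂ f ξ) (G f c ξ) = 0 := by
  rw [T₁₂, dzM_eq, dzbM_eq, ip_neg_left, ip_smul_left, ip, R.trace_mul_G hξ, R.fd_comm_dP_P hξ,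
    R.P_comm_dP_mulVec hξ]
  simp

lemma Regular.ip_T₁₂_T₁ (R : Regular f U) (hξ : ξ ∈ U) : ip (T₁₂ f ξ) (T₁ f ξ) = 0 := by
  rw [T₁_eq, ip_smul_right, R.ip_T₁₂_G hξ, mul_zero]

lemma Regular.ip_T₁₂_T₂ (R : Regular f U) (hξ : ξ ∈ U) : ip (T₁₂ f ξ) (T₂ f ξ) = 0 := by
  rw [T₂_eq, ip_smul_right, R.ip_T₁₂_G hξ, mul_zero]

lemma star_sw (x y : Fin (N + 1) → ℂ) : star (sw f ξ x y) = sw f ξ (star y) (star x) := by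
  rw [sw, sw, ← Matrix.star_dotProduct_star, star_P_mulVec, Matrix.dotProduct_mulVec]

lemma dWV_fd (c : ℂ) : dWV c (fd f) ξ = star (dWV (star c) f ξ) := dWV_star c f

lemma J_eq : J f ξ = (nf f ξ)⁻¹ * sw f ξ (dWV (-Complex.I) (fd f) ξ) (dWV (-Complex.I) f ξ) := by
  rw [J, dzV_eq]

lemma star_J :
    star (J f ξ) = (nf f ξ)⁻¹ * sw f ξ (dWV Complex.I (fd f) ξ) (dWV Complex.I f ξ) := by
  rw [J_eq, star_mul', star_inv₀, nf_star, star_sw, dWV_fd, dWV_fd]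
  simp

lemma Regular.ip_T₁_T₁ (R : Regular f U) (hξ : ξ ∈ U) : ip (T₁ f ξ) (T₁ f ξ) = -2 * J f ξ := by
  rw [T₁_eq, ip_smul_left, ip_smul_right, ip, R.trace_G_mul_G hξ, J_eq]
  linear_combination (2 * (nf f ξ)⁻¹ * sw f ξ (dWV (-Complex.I) (fd f) ξ) (dWV (-Complex.I) f ξ)) *
    Complex.I_mul_I

lemma Regular.ip_T₂_T₂ (R : Regular f U) (hξ : ξ ∈ U) :
    ip (T₂ f ξ) (T₂ f ξ) = -2 * star (J f ξ) := by
  rw [T₂_eq, ip_smul_left, ip_smul_right, ip, R.trace_G_mul_G hξ, star_J]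
  linear_combination (2 * (nf f ξ)⁻¹ * sw f ξ (dWV Complex.I (fd f) ξ) (dWV Complex.I f ξ)) *
    Complex.I_mul_I

lemma Regular.ip_T₁_T₂ (R : Regular f U) (hξ : ξ ∈ U) :
    ip (T₁ f ξ) (T₂ f ξ) = (nf f ξ)⁻¹ *
      (sw f ξ (dWV (-Complex.I) (fd f) ξ) (dWV Complex.I f ξ) +
        sw f ξ (dWV Complex.I (fd f) ξ) (dWV (-Complex.I) f ξ)) := by
  rw [T₁_eq, T₂_eq, ip_smul_left, ip_smul_right, ip, R.trace_G_mul_G hξ]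
  linear_combination (-(nf f ξ)⁻¹ * (sw f ξ (dWV (-Complex.I) (fd f) ξ) (dWV Complex.I f ξ) +
        sw f ξ (dWV Complex.I (fd f) ξ) (dWV (-Complex.I) f ξ))) *
    Complex.I_mul_I

lemma star_metric₁₁ : star (ip (T₁ f ξ) (T₁ f ξ)) = ip (T₂ f ξ) (T₂ f ξ) := by
  rw [star_ip, T₁_conjTranspose, ip_neg_left, ip_neg_right, neg_neg]

lemma star_metric₁₂ : star (ip (T₁ f ξ) (T₂ f ξ)) = ip (T₁ f ξ) (T₂ f ξ) := by
  rw [star_ip, T₁_conjTranspose, T₂_conjTranspose, ip_neg_left, ip_neg_right, neg_neg, ip_comm]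

lemma star_metricDet : star (metricDet (T₁ f) (T₂ f) ξ) = metricDet (T₁ f) (T₂ f) ξ := by
  rw [metricDet, star_sub, star_mul', star_pow, star_metric₁₂, star_metric₁₁, ← star_metric₁₁,
    star_star]
  ring

lemma Regular.ip_dT₁_T₁ (R : Regular f U) (hξ : ξ ∈ U) :
    ip (dzM (T₁ f) ξ) (T₁ f ξ) = -(nf f ξ)⁻¹ *
      (sw f ξ (dzV (dzV (fd f)) ξ) (dzV f ξ) + sw f ξ (dzV (fd f) ξ) (dzV (dzV f) ξ)) +
      2 * (nf f ξ)⁻¹ * (fd f ξ ⬝ᵥ dzV f ξ + dzV (fd f) ξ ⬝ᵥ f ξ) * J f ξ := by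
  rw [T₁_eq, dzM_eq, dWM_const_smul _ _ (R.smG hξ _), ip_smul_left, ip_smul_right, ip,
    R.trace_dG_mul_G hξ, J_eq, dzV_eq]
  linear_combination (((nf f ξ)⁻¹ *
      (sw f ξ (dWV (-Complex.I) (dWV (-Complex.I) (fd f)) ξ) (dWV (-Complex.I) f ξ) +
       sw f ξ (dWV (-Complex.I) (fd f) ξ) (dWV (-Complex.I) (dWV (-Complex.I) f) ξ) -
      2 * (nf f ξ)⁻¹ * (fd f ξ ⬝ᵥ dWV (-Complex.I) f ξ + dWV (-Complex.I) (fd f) ξ ⬝ᵥ f ξ) *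
        sw f ξ (dWV (-Complex.I) (fd f) ξ) (dWV (-Complex.I) f ξ)))) * Complex.I_mul_I

lemma Regular.ip_dT₁_T₂ (R : Regular f U) (hξ : ξ ∈ U) :
    ip (dzM (T₁ f) ξ) (T₂ f ξ) = (nf f ξ)⁻¹ *
      (sw f ξ (dzV (dzV (fd f)) ξ) (dzbV f ξ) + sw f ξ (dzbV (fd f) ξ) (dzV (dzV f) ξ)) -
      2 * (nf f ξ)⁻¹ ^ 2 * ((fd f ξ ⬝ᵥ dzV f ξ) * sw f ξ (dzbV (fd f) ξ) (dzV f ξ)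
          + (dzV (fd f) ξ ⬝ᵥ f ξ) * sw f ξ (dzV (fd f) ξ) (dzbV f ξ)) := by
  rw [T₁_eq, T₂_eq, dzM_eq, dWM_const_smul _ _ (R.smG hξ _), ip_smul_left, ip_smul_right, ip,
    R.trace_dG_mul_G hξ, dzV_eq, dzbV_eq]
  linear_combination (-((nf f ξ)⁻¹ *
      (sw f ξ (dWV (-Complex.I) (dWV (-Complex.I) (fd f)) ξ) (dWV Complex.I f ξ) +
       sw f ξ (dWV Complex.I (fd f) ξ) (dWV (-Complex.I) (dWV (-Complex.I) f) ξ) -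
      2 * (nf f ξ)⁻¹ * ((fd f ξ ⬝ᵥ dWV (-Complex.I) f ξ) *
        sw f ξ (dWV Complex.I (fd f) ξ) (dWV (-Complex.I) f ξ) +
        (dWV (-Complex.I) (fd f) ξ ⬝ᵥ f ξ) *
        sw f ξ (dWV (-Complex.I) (fd f) ξ) (dWV Complex.I f ξ))))) * Complex.I_mul_I

lemma sw_sub_left (x y z : Fin (N + 1) → ℂ) : sw f ξ (x - y) z = sw f ξ x z - sw f ξ y z :=
  sub_dotProduct _ _ _

lemma sw_smul_left (a : ℂ) (x z : Fin (N + 1) → ℂ) : sw f ξ (a • x) z = a * sw f ξ x z :=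
  smul_dotProduct _ _ _

lemma sw_sub_right (x y z : Fin (N + 1) → ℂ) : sw f ξ x (y - z) = sw f ξ x y - sw f ξ x z := by
  simp only [sw, Matrix.mulVec_sub, dotProduct_sub]

lemma sw_smul_right (a : ℂ) (x z : Fin (N + 1) → ℂ) : sw f ξ x (a • z) = a * sw f ξ x z := by
  simp only [sw, Matrix.mulVec_smul, dotProduct_smul, smul_eq_mul]

/-- Cramer's rule for the Gram matrix of `T₁`, `T₂`: the explicit expression in `f` is the
`T₁`-coefficient of `∂T₁`. -/
lemma Regular.a₁₁_eq (R : Regular f U) (hξ : ξ ∈ U) :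
    a₁₁ f (T₁ f) (T₂ f) ξ = (metricDet (T₁ f) (T₂ f) ξ)⁻¹ *
      (ip (dzM (T₁ f) ξ) (T₁ f ξ) * ip (T₂ f ξ) (T₂ f ξ) -
        ip (dzM (T₁ f) ξ) (T₂ f ξ) * ip (T₁ f ξ) (T₂ f ξ)) := by
  rw [R.ip_dT₁_T₁ hξ, R.ip_dT₁_T₂ hξ, R.ip_T₂_T₂ hξ]
  simp only [a₁₁, sw_sub_left, sw_smul_left, sw_sub_right, sw_smul_right, div_eq_mul_inv, inv_pow]
  ring

lemma Regular.a₁₂_eq (R : Regular f U) (hξ : ξ ∈ U) :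
    a₁₂ f (T₁ f) (T₂ f) ξ = (metricDet (T₁ f) (T₂ f) ξ)⁻¹ *
      (ip (dzM (T₁ f) ξ) (T₂ f ξ) * ip (T₁ f ξ) (T₁ f ξ) -
        ip (dzM (T₁ f) ξ) (T₁ f ξ) * ip (T₁ f ξ) (T₂ f ξ)) := by
  rw [R.ip_dT₁_T₁ hξ, R.ip_dT₁_T₂ hξ, R.ip_T₁_T₁ hξ]
  simp only [a₁₂, sw_sub_left, sw_smul_left, sw_sub_right, sw_smul_right, div_eq_mul_inv, inv_pow]
  ring

end Tangent

/-! ### The sigma model equation as the vanishing of `W`. -/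

section Equation

variable {N : ℕ} {f : ℂ → Fin (N + 1) → ℂ} {U : Set ℂ} {ξ : ℂ}

/-- The left hand side of the equations of the sigma model. -/
def tension (f : ℂ → Fin (N + 1) → ℂ) (ξ : ℂ) : Fin (N + 1) → ℂ :=
  P f ξ *ᵥ (dzV (dzbV f) ξ - (nf f ξ)⁻¹ •
    ((fd f ξ ⬝ᵥ dzbV f ξ) • dzV f ξ + (fd f ξ ⬝ᵥ dzV f ξ) • dzbV f ξ))

lemma Regular.P_W_mulVec_self (R : Regular f U) (hξ : ξ ∈ U) :
    P f ξ *ᵥ (W f ξ *ᵥ f ξ) = tension f ξ := by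
  have h := R.P_dG_mulVec_self hξ Complex.I (-Complex.I)
  rw [R.dG_eq hξ, Matrix.add_mulVec, Matrix.mulVec_add, R.P_comm_dP_mulVec hξ, add_zero] at h
  rw [W, h, tension, dzV_eq, dzbV_eq]

lemma Regular.fd_W_P (R : Regular f U) (hξ : ξ ∈ U) :
    (fd f ξ ᵥ* W f ξ) ᵥ* P f ξ = -star (tension f ξ) := by
  rw [← R.P_W_mulVec_self hξ, star_P_mulVec, Matrix.star_mulVec, R.W_conjTranspose hξ,
    Matrix.vecMul_neg, Matrix.neg_vecMul, neg_neg, fd]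

lemma one_eq_P_add (f : ℂ → Fin (N + 1) → ℂ) (ξ : ℂ) :
    (1 : Mat N) = P f ξ + (nf f ξ)⁻¹ • Matrix.vecMulVec (f ξ) (fd f ξ) := by
  simp [P]

/-- The tension is the block `P W f`, the opposite block is minus its adjoint, and a commutator with
`P` has no diagonal blocks. -/
lemma Regular.W_eq_zero_iff (R : Regular f U) (hξ : ξ ∈ U) : W f ξ = 0 ↔ tension f ξ = 0 := by
  have h0 := R.ne_zero ξ hξ
  refine ⟨fun h => by rw [← R.P_W_mulVec_self hξ, h]; simp, fun h => ?_⟩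
  have h1 := R.P_W_mulVec_self hξ
  have h2 := R.fd_W_P hξ
  rw [h, star_zero, neg_zero] at h2
  rw [h] at h1
  have h3 : P f ξ * W f ξ = 0 := by
    have := sandwich_W h0
    rw [← mul_one (P f ξ * W f ξ), one_eq_P_add f ξ, mul_add, this, Matrix.mul_smul,
      Matrix.mul_vecMulVec, ← Matrix.mulVec_mulVec, h1]
    simp
  have h4 : W f ξ * P f ξ = 0 := by
    have := R.W_conjTranspose hξ
    rw [← neg_eq_iff_eq_neg] at this
    rw [← this, ← P_conjTranspose f ξ, neg_mul, ← Matrix.conjTranspose_mul, h3]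
    simp
  -- With `X = ∂∂̄P` and `Q = P`: `QW = 0` gives `QX = QXQ`, and `WQ = 0` gives `XQ = QXQ`. Hence
  -- `X` commutes with `Q`.
  rw [W, comm] at h3 h4 ⊢
  set X := dWM (-Complex.I) (dWM Complex.I (P f)) ξ
  set Q := P f ξ
  have hQ : Q * Q = Q := P_mul_P h0
  have h5 : Q * X * Q = Q * X := by
    rw [mul_sub, ← mul_assoc, ← mul_assoc, hQ] at h3
    exact sub_eq_zero.1 h3
  have h6 : X * Q = Q * X * Q := by
    rw [sub_mul, mul_assoc, hQ] at h4
    exact sub_eq_zero.1 h4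
  rw [h6, h5, sub_self]

lemma Regular.isSolution_iff (R : Regular f U) : IsSolution f U ↔ ∀ ξ ∈ U, W f ξ = 0 :=
  forall₂_congr fun _ hξ => (R.W_eq_zero_iff hξ).symm

/-- If the block `P ∂W P` vanishes then the tension is parallel to both `P ∂f` and `P ∂̄f`. -/
lemma Regular.tension_parallel (R : Regular f U) (hξ : ξ ∈ U)
    (h : P f ξ * dzM (W f) ξ * P f ξ = 0) :
    Matrix.vecMulVec (P f ξ *ᵥ dWV (-Complex.I) f ξ) (star (tension f ξ)) =
      Matrix.vecMulVec (tension f ξ) (dWV (-Complex.I) (fd f) ξ ᵥ* P f ξ) := by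
  have h0 := R.ne_zero ξ hξ
  have sP := R.smP hξ
  have sW := R.smW hξ
  -- Differentiate `PWP = 0` and sandwich again: by hypothesis the term with `∂W` drops out, and the
  -- two terms with `∂P` are the rank one matrices of the claim.
  have h1 : dWM (-Complex.I) (fun ζ => P f ζ * W f ζ * P f ζ) ξ = 0 := by
    rw [← dWM_const (ξ := ξ) (-Complex.I) (0 : Mat N)]
    exact dWM_congr _ (R.eventually hξ fun ζ hζ => sandwich_W (R.ne_zero ζ hζ))
  rw [dWM_mul _ (sP.mul sW) sP, dWM_mul _ sP sW, ← dzM_eq] at h1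
  have h2 := congrArg (fun Z => P f ξ * Z * P f ξ) h1
  simp only [mul_add, add_mul, mul_zero, zero_mul] at h2
  have h3 : P f ξ * (P f ξ * dzM (W f) ξ * P f ξ) * P f ξ = 0 := by rw [h]; simp
  rw [h3, add_zero, dzM_eq] at h2
  have e1 : P f ξ * dWM (-Complex.I) (P f) ξ =
      -((nf f ξ)⁻¹ • Matrix.vecMulVec (P f ξ *ᵥ dWV (-Complex.I) f ξ) (fd f ξ)) := by
    rw [R.dP hξ, mul_neg, Matrix.mul_smul, mul_add, Matrix.mul_vecMulVec, Matrix.mul_vecMulVec,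
      P_mulVec_P h0, P_mulVec_self h0, Matrix.zero_vecMulVec, add_zero]
  have e2 : dWM (-Complex.I) (P f) ξ * P f ξ =
      -((nf f ξ)⁻¹ • Matrix.vecMulVec (f ξ) (dWV (-Complex.I) (fd f) ξ ᵥ* P f ξ)) := by
    rw [R.dP hξ, neg_mul, Matrix.smul_mul, add_mul, Matrix.vecMulVec_mul, Matrix.vecMulVec_mul,
      vecMul_P_P h0, fd_vecMul_P h0, Matrix.vecMulVec_zero, zero_add]
  have e3 : P f ξ * (dWM (-Complex.I) (P f) ξ * W f ξ * P f ξ) * P f ξ =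
      (nf f ξ)⁻¹ • Matrix.vecMulVec (P f ξ *ᵥ dWV (-Complex.I) f ξ) (star (tension f ξ)) := by
    have : P f ξ * (dWM (-Complex.I) (P f) ξ * W f ξ * P f ξ) * P f ξ =
        P f ξ * dWM (-Complex.I) (P f) ξ * W f ξ * (P f ξ * P f ξ) := by noncomm_ring
    rw [this, P_mul_P h0, e1, neg_mul, neg_mul, Matrix.smul_mul, Matrix.smul_mul,
      Matrix.vecMulVec_mul, Matrix.vecMulVec_mul, R.fd_W_P hξ, Matrix.vecMulVec_neg, smul_neg,
      neg_neg]
  have e4 : P f ξ * (P f ξ * W f ξ * dWM (-Complex.I) (P f) ξ) * P f ξ =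
      -((nf f ξ)⁻¹ • Matrix.vecMulVec (tension f ξ) (dWV (-Complex.I) (fd f) ξ ᵥ* P f ξ)) := by
    have : P f ξ * (P f ξ * W f ξ * dWM (-Complex.I) (P f) ξ) * P f ξ =
        P f ξ * P f ξ * W f ξ * (dWM (-Complex.I) (P f) ξ * P f ξ) := by noncomm_ring
    rw [this, P_mul_P h0, e2, mul_neg, Matrix.mul_smul, Matrix.mul_vecMulVec,
      ← Matrix.mulVec_mulVec, R.P_W_mulVec_self hξ]
  rw [e3, e4, ← sub_eq_add_neg, ← smul_sub] at h2
  exact sub_eq_zero.1 ((smul_eq_zero.1 h2).resolve_left (inv_ne_zero (nf_ne h0)))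

/-- If the tension `Y` were nonzero, the rank one identity would give `P∂f = tY` and `∂f†P = tY†`
with one scalar `t`. Then `4|J|²` and `g_{ξξ̄}²` both equal `4|t|⁴(Y†Y)²/(f†f)²`, so `g = 0`. -/
lemma Regular.W_eq_zero_of_sandwich (R : Regular f U) (hξ : ξ ∈ U)
    (hg : metricDet (T₁ f) (T₂ f) ξ ≠ 0) (h : P f ξ * dzM (W f) ξ * P f ξ = 0) : W f ξ = 0 := by
  have h0 := R.ne_zero ξ hξ
  rw [R.W_eq_zero_iff hξ]
  by_contra hY
  have hp := R.tension_parallel hξ h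
  set Y := tension f ξ with hYdef
  set u := P f ξ *ᵥ dWV (-Complex.I) f ξ with hu
  set r := dWV (-Complex.I) (fd f) ξ ᵥ* P f ξ with hr
  obtain ⟨i, hi⟩ := Function.ne_iff.1 hY
  have hi' : Y i ≠ 0 := hi
  have hi2 : star (Y i) ≠ 0 := star_ne_zero.2 hi'
  have hp' : ∀ k l, u k * star (Y l) = Y k * r l := fun k l => congrFun (congrFun hp k) l
  -- Row `i` of the identity, where `Y i ≠ 0`, determines `r`; column `i` then determines `u` with
  -- the same factor.
  have hr' : r = (u i / Y i) • star Y := by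
    ext l
    have := hp' i l
    simp only [Pi.smul_apply, smul_eq_mul, Pi.star_apply]
    field_simp
    linear_combination -this
  have hu' : u = (u i / Y i) • Y := by
    ext k
    have h1 := hp' k i
    have h2 := congrFun hr' i
    simp only [Pi.smul_apply, smul_eq_mul, Pi.star_apply] at h2 ⊢
    rw [h2] at h1
    apply mul_right_cancel₀ hi2
    linear_combination h1
  generalize u i / Y i = t at hr' hu'
  have hru : P f ξ *ᵥ dWV Complex.I f ξ = star r := by
    rw [hr, star_vecMul_P, dWV_fd]; simp
  have hur : dWV Complex.I (fd f) ξ ᵥ* P f ξ = star u := by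
    rw [hu, star_P_mulVec, dWV_fd]; simp
  have hsw : ∀ x y, sw f ξ x y = (x ᵥ* P f ξ) ⬝ᵥ (P f ξ *ᵥ y) := fun x y => by
    rw [sw, ← Matrix.dotProduct_mulVec, P_mulVec_P h0]
  apply hg
  rw [metricDet, R.ip_T₁_T₁ hξ, R.ip_T₂_T₂ hξ, R.ip_T₁_T₂ hξ, star_J, J_eq]
  simp only [hsw, ← hu, ← hr, hru, hur]
  rw [hr', hu']
  simp only [star_smul, star_star, smul_dotProduct, dotProduct_smul, smul_eq_mul]
  ring

end Equation

/-! ### Expansion of traceless matrices in a frame at a point. -/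

section Pointwise

variable {N : ℕ}

/-- The frame at a point, assembled from two tangent vectors and the normal vectors. -/
def vframe (E₁ E₂ : Mat N) (ν : Fin (N * (N + 2) - 2) → Mat N) : Idx N → Mat N :=
  Sum.elim ![E₁, E₂] ν

/-- The coefficients of a traceless matrix with respect to a moving frame. -/
def coef (E₁ E₂ : Mat N) (ν : Fin (N * (N + 2) - 2) → Mat N) (Z : Mat N) : Idx N → ℂ :=
  Sum.elim ![(ip E₁ E₁ * ip E₂ E₂ - ip E₁ E₂ ^ 2)⁻¹ * (ip Z E₁ * ip E₂ E₂ - ip Z E₂ * ip E₁ E₂),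
    (ip E₁ E₁ * ip E₂ E₂ - ip E₁ E₂ ^ 2)⁻¹ * (ip Z E₂ * ip E₁ E₁ - ip Z E₁ * ip E₁ E₂)]
    fun k => ip Z (ν k)

/-- Traceless tangent vectors with nondegenerate metric and an orthonormal family of normals. -/
structure IsFrameAt (E₁ E₂ : Mat N) (ν : Fin (N * (N + 2) - 2) → Mat N) : Prop where
  trace₁ : E₁.trace = 0
  trace₂ : E₂.trace = 0
  traceν : ∀ k, (ν k).trace = 0
  orth₁ : ∀ k, ip E₁ (ν k) = 0
  orth₂ : ∀ k, ip E₂ (ν k) = 0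
  orthonormal : ∀ j k, ip (ν j) (ν k) = if j = k then 1 else 0
  det_ne : ip E₁ E₁ * ip E₂ E₂ - ip E₁ E₂ ^ 2 ≠ 0

variable {E₁ E₂ : Mat N} {ν : Fin (N * (N + 2) - 2) → Mat N}

lemma sum_vframe (c : Idx N → ℂ) : ∑ l, c l • vframe E₁ E₂ ν l =
    c (Sum.inl 0) • E₁ + c (Sum.inl 1) • E₂ + ∑ k, c (Sum.inr k) • ν k := by
  simp [Fintype.sum_sum_type, Fin.sum_univ_two, vframe]

lemma IsFrameAt.ip_sum_ν (F : IsFrameAt E₁ E₂ ν) (c : Idx N → ℂ) (k : Fin (N * (N + 2) - 2)) :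
    ip (∑ l, c l • vframe E₁ E₂ ν l) (ν k) = c (Sum.inr k) := by
  rw [sum_vframe, ip_add_left, ip_add_left, ip_smul_left, ip_smul_left, ip_sum_left, F.orth₁,
    F.orth₂]
  simp [ip_smul_left, F.orthonormal]

lemma IsFrameAt.ip_sum_E₁ (F : IsFrameAt E₁ E₂ ν) (c : Idx N → ℂ) :
    ip (∑ l, c l • vframe E₁ E₂ ν l) E₁ =
      c (Sum.inl 0) * ip E₁ E₁ + c (Sum.inl 1) * ip E₁ E₂ := by
  rw [sum_vframe, ip_add_left, ip_add_left, ip_smul_left, ip_smul_left, ip_sum_left, ip_comm E₂]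
  simp [ip_smul_right, ip_comm _ E₁, F.orth₁]

lemma IsFrameAt.ip_sum_E₂ (F : IsFrameAt E₁ E₂ ν) (c : Idx N → ℂ) :
    ip (∑ l, c l • vframe E₁ E₂ ν l) E₂ =
      c (Sum.inl 0) * ip E₁ E₂ + c (Sum.inl 1) * ip E₂ E₂ := by
  rw [sum_vframe, ip_add_left, ip_add_left, ip_smul_left, ip_smul_left, ip_sum_left]
  simp [ip_smul_right, ip_comm _ E₂, F.orth₂]

/-- The Gram matrix is block diagonal: a nondegenerate tangential block, inverted by Cramer's rule,
and an identity block for the normals. Independence follows at once. -/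
lemma IsFrameAt.coef_sum (F : IsFrameAt E₁ E₂ ν) (c : Idx N → ℂ) :
    coef E₁ E₂ ν (∑ l, c l • vframe E₁ E₂ ν l) = c := by
  have hg := F.det_ne
  funext i
  rcases i with i | k
  · fin_cases i
    · simp only [coef, F.ip_sum_E₁, F.ip_sum_E₂, Sum.elim_inl]
      simp only [Fin.zero_eta, Matrix.cons_val_zero]
      rw [inv_mul_eq_iff_eq_mul₀ hg]
      ring
    · simp only [coef, F.ip_sum_E₁, F.ip_sum_E₂, Sum.elim_inl]
      simp only [Fin.mk_one, Matrix.cons_val_one, Matrix.cons_val_fin_one]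
      rw [inv_mul_eq_iff_eq_mul₀ hg]
      ring
  · simp only [coef, Sum.elim_inr, F.ip_sum_ν]

lemma IsFrameAt.linearIndependent (F : IsFrameAt E₁ E₂ ν) :
    LinearIndependent ℂ (vframe E₁ E₂ ν) := by
  rw [Fintype.linearIndependent_iff]
  intro c hc i
  rw [← F.coef_sum c, hc]
  rcases i with i | k
  · fin_cases i <;> simp [coef, ip_zero_left]
  · simp [coef, ip_zero_left]

/-- A traceless `1 × 1` matrix vanishes. Excluding `N = 0` makes the truncated difference `N * (N +
2) - 2` the true number of normals. -/
lemma one_le_of_det_ne (h : E₁.trace = 0) (hd : ip E₁ E₁ * ip E₂ E₂ - ip E₁ E₂ ^ 2 ≠ 0) :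
    1 ≤ N := by
  by_contra hN
  obtain rfl : N = 0 := by omega
  apply hd
  have h1 : E₁ = 0 := by
    simp only [Matrix.trace, Matrix.diag_apply, Nat.reduceAdd, Finset.univ_unique,
      Fin.default_eq_zero, Finset.sum_singleton] at h
    ext i j
    fin_cases i; fin_cases j; exact h
  rw [h1, ip_zero_left, ip_zero_left]; ring

/-- The space `sl(N+1)` of traceless matrices. -/
def sl (N : ℕ) : Submodule ℂ (Mat N) := LinearMap.ker (Matrix.traceLinearMap (Fin (N + 1)) ℂ ℂ)

lemma mem_sl {X : Mat N} : X ∈ sl N ↔ X.trace = 0 := by simp [sl]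

lemma finrank_sl (N : ℕ) : Module.finrank ℂ (sl N) = N * (N + 2) := by
  have h := LinearMap.finrank_range_add_finrank_ker (Matrix.traceLinearMap (Fin (N + 1)) ℂ ℂ)
  have hr : LinearMap.range (Matrix.traceLinearMap (Fin (N + 1)) ℂ ℂ) = ⊤ := by
    rw [LinearMap.range_eq_top]
    intro z
    exact ⟨Matrix.single 0 0 z, by simp⟩
  rw [hr, finrank_top, Module.finrank_self, Module.finrank_matrix] at h
  simp only [Fintype.card_fin, Module.finrank_self, mul_one] at h
  change 1 + Module.finrank ℂ (sl N) = _ at h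
  nlinarith

lemma IsFrameAt.mem_span (F : IsFrameAt E₁ E₂ ν) {Z : Mat N} (hZ : Z.trace = 0) :
    ∃ c : Idx N → ℂ, ∑ l, c l • vframe E₁ E₂ ν l = Z := by
  have hm : ∀ l, vframe E₁ E₂ ν l ∈ sl N := by
    rintro (i | k)
    · fin_cases i
      · exact mem_sl.2 F.trace₁
      · exact mem_sl.2 F.trace₂
    · exact mem_sl.2 (F.traceν k)
  have hN := one_le_of_det_ne F.trace₁ F.det_ne
  let w : Idx N → sl N := fun l => ⟨vframe E₁ E₂ ν l, hm l⟩
  have hw : LinearIndependent ℂ w := LinearIndependent.of_comp (sl N).subtype F.linearIndependent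
  have hcard : Fintype.card (Idx N) = Module.finrank ℂ (sl N) := by
    rw [finrank_sl, Fintype.card_sum, Fintype.card_fin, Fintype.card_fin]
    have : 2 ≤ N * (N + 2) := by nlinarith
    omega
  have : Nonempty (Idx N) := ⟨Sum.inl 0⟩
  have hs := hw.span_eq_top_of_card_eq_finrank hcard
  have hz : (⟨Z, mem_sl.2 hZ⟩ : sl N) ∈ Submodule.span ℂ (Set.range w) := by
    rw [hs]; trivial
  rw [Submodule.mem_span_range_iff_exists_fun] at hz
  obtain ⟨c, hc⟩ := hz
  refine ⟨c, ?_⟩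
  have := congrArg (sl N).subtype hc
  simpa [w] using this

lemma IsFrameAt.expand (F : IsFrameAt E₁ E₂ ν) {Z : Mat N} (hZ : Z.trace = 0) :
    ∑ l, coef E₁ E₂ ν Z l • vframe E₁ E₂ ν l = Z := by
  obtain ⟨c, rfl⟩ := F.mem_span hZ
  rw [F.coef_sum]

end Pointwise

/-! ### The curvature of a pair of connection matrices. -/

section Compatibility

variable {N : ℕ} {ξ : ℂ}

/-- The Leibniz rule alone; no equation for `η` is assumed. The last two sums carry the failure of
`∂η = aη` and `∂̄η = bη`, which is what the converse in (b) has to control. -/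
lemma sum_curvature {η : Idx N → ℂ → Mat N} {a b : ℂ → Matrix (Idx N) (Idx N) ℂ}
    (hη : ∀ l, SmM (η l) ξ) (ha : SmM a ξ) (hb : SmM b ξ) (i : Idx N) :
    ∑ l, (dzbM a ξ - dzM b ξ + comm (a ξ) (b ξ)) i l • η l ξ =
      dzbM (fun ζ => ∑ l, a ζ i l • η l ζ) ξ - dzM (fun ζ => ∑ l, b ζ i l • η l ζ) ξ +
      ∑ l, a ξ i l • (∑ k, b ξ l k • η k ξ - dzbM (η l) ξ) -
      ∑ l, b ξ i l • (∑ k, a ξ l k • η k ξ - dzM (η l) ξ) := by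
  rw [dzM_eq, dzbM_eq, dzM_eq, dzbM_eq, dWM_sum _ _ fun l _ => SmM.smul (ha i l) (hη l),
    dWM_sum _ _ fun l _ => SmM.smul (hb i l) (hη l)]
  simp only [dWM_smul _ (ha i _) (hη _), dWM_smul _ (hb i _) (hη _), Matrix.add_apply,
    Matrix.sub_apply, comm, Matrix.mul_apply, add_smul, sub_smul, Finset.sum_add_distrib,
    Finset.sum_sub_distrib, smul_sub, Finset.smul_sum, Finset.sum_smul, smul_smul]
  rw [Finset.sum_comm (f := fun l k => (a ξ i k * b ξ k l) • η l ξ),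
    Finset.sum_comm (f := fun l k => (b ξ i k * a ξ k l) • η l ξ)]
  simp only [dWM, Matrix.of_apply]
  abel

end Compatibility

/-! ### Gauss–Weingarten and Gauss–Codazzi–Ricci equations, with defects. -/

section Structure

variable {N : ℕ} {f : ℂ → Fin (N + 1) → ℂ} {U : Set ℂ} {ξ : ℂ}
  {ν : Fin (N * (N + 2) - 2) → ℂ → Mat N}

lemma frame_apply (E₁ E₂ : ℂ → Mat N) (ν : Fin (N * (N + 2) - 2) → ℂ → Mat N) (i : Idx N) (ξ : ℂ) :
    frame E₁ E₂ ν i ξ = vframe (E₁ ξ) (E₂ ξ) (fun k => ν k ξ) i := by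
  rcases i with i | k
  · fin_cases i <;> rfl
  · rfl

/-- The frame built from the tangent fields `i K†`, `i K` of a nondegenerate field `f`. -/
structure IsMovingFrame (f : ℂ → Fin (N + 1) → ℂ) (ν : Fin (N * (N + 2) - 2) → ℂ → Mat N)
    (U : Set ℂ) : Prop where
  regular : Regular f U
  det_ne : ∀ ξ ∈ U, metricDet (T₁ f) (T₂ f) ξ ≠ 0
  normal : IsNormalFrame (T₁ f) (T₂ f) ν U

lemma IsMovingFrame.smν (F : IsMovingFrame f ν U) (hξ : ξ ∈ U) (k) : SmM (ν k) ξ := fun i j =>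
  (F.normal.smooth k i j).contDiffAt (F.regular.isOpen.mem_nhds hξ)

lemma IsMovingFrame.at (F : IsMovingFrame f ν U) (hξ : ξ ∈ U) :
    IsFrameAt (T₁ f ξ) (T₂ f ξ) (fun k => ν k ξ) where
  trace₁ := trace_T₁
  trace₂ := trace_T₂
  traceν k := (F.normal.mem k ξ hξ).2
  orth₁ k := F.normal.orth₁ k ξ hξ
  orth₂ k := F.normal.orth₂ k ξ hξ
  orthonormal j k := F.normal.orthonormal j k ξ hξ
  det_ne := F.det_ne ξ hξ

lemma IsMovingFrame.linearIndependent (F : IsMovingFrame f ν U) (hξ : ξ ∈ U) :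
    LinearIndependent ℂ (fun i => frame (T₁ f) (T₂ f) ν i ξ) := by
  simp only [frame_apply]
  exact (F.at hξ).linearIndependent

lemma IsMovingFrame.smFrame (F : IsMovingFrame f ν U) (hξ : ξ ∈ U) (i : Idx N) :
    SmM (frame (T₁ f) (T₂ f) ν i) ξ := by
  rcases i with i | k
  · fin_cases i
    · exact F.regular.smT₁ hξ
    · exact F.regular.smT₂ hξ
  · exact F.smν hξ k

lemma IsMovingFrame.ip_dν_T₁ (F : IsMovingFrame f ν U) (hξ : ξ ∈ U) (k) :
    ip (dzM (ν k) ξ) (T₁ f ξ) = -Jn (T₁ f) ν ξ k := by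
  have h : dW (-Complex.I) (fun ζ => ip (T₁ f ζ) (ν k ζ)) ξ = 0 := by
    rw [← dW_const (ξ := ξ) (-Complex.I) 0]
    exact dW_congr _ (F.regular.eventually hξ fun ζ hζ => F.normal.orth₁ k ζ hζ)
  rw [dW_ip _ (F.regular.smT₁ hξ) (F.smν hξ k)] at h
  rw [Jn, dzM_eq, ip_comm]
  linear_combination h

/-- Differentiate `(T₂, ν_k) = 0`. The coefficient `H_k` is formed with `T₁₂` rather than `∂T₂`,
which leaves a term in `W`. -/
lemma IsMovingFrame.ip_dν_T₂ (F : IsMovingFrame f ν U) (hξ : ξ ∈ U) (k) :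
    ip (dzM (ν k) ξ) (T₂ f ξ) = -Hn (T₁₂ f) ν ξ k - Complex.I * ip (W f ξ) (ν k ξ) := by
  have h : dW (-Complex.I) (fun ζ => ip (T₂ f ζ) (ν k ζ)) ξ = 0 := by
    rw [← dW_const (ξ := ξ) (-Complex.I) 0]
    exact dW_congr _ (F.regular.eventually hξ fun ζ hζ => F.normal.orth₂ k ζ hζ)
  rw [dW_ip _ (F.regular.smT₂ hξ) (F.smν hξ k), ← dzM_eq, F.regular.dzM_T₂ hξ, ip_add_left,
    ip_smul_left] at h
  rw [Hn, ip_comm]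
  linear_combination h

lemma IsMovingFrame.S_add_S (F : IsMovingFrame f ν U) (hξ : ξ ∈ U) (j k) :
    S ν ξ j k + S ν ξ k j = 0 := by
  have h : dW (-Complex.I) (fun ζ => ip (ν j ζ) (ν k ζ)) ξ = 0 := by
    rw [← dW_const (ξ := ξ) (-Complex.I) (if j = k then 1 else 0)]
    exact dW_congr _ (F.regular.eventually hξ fun ζ hζ => F.normal.orthonormal j k ζ hζ)
  rw [dW_ip _ (F.smν hξ j) (F.smν hξ k)] at h
  rw [S, Matrix.of_apply, Matrix.of_apply, dzM_eq, ip_comm _ (ν j ξ)]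
  exact h

lemma trace_dW_eq_zero (R : Regular f U) (hξ : ξ ∈ U) (c : ℂ) {Z : ℂ → Mat N} (hs : SmM Z ξ)
    (h : ∀ ζ ∈ U, (Z ζ).trace = 0) : (dWM c Z ξ).trace = 0 := by
  rw [← dW_trace c hs, ← dW_const (ξ := ξ) c 0]
  exact dW_congr _ (R.eventually hξ h)

lemma IsMovingFrame.sum_A_zero (F : IsMovingFrame f ν U) (hξ : ξ ∈ U) :
    ∑ l, A f (T₁ f) (T₂ f) (T₁₂ f) ν ξ (Sum.inl 0) l • frame (T₁ f) (T₂ f) ν l ξ =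
      dzM (T₁ f) ξ := by
  have hR := F.regular
  have ht : (dzM (T₁ f) ξ).trace = 0 := by
    rw [dzM_eq]; exact trace_dW_eq_zero hR hξ _ (hR.smT₁ hξ) fun ζ _ => trace_T₁
  rw [← (F.at hξ).expand ht]
  simp only [frame_apply]
  refine Finset.sum_congr rfl fun l _ => congrArg (· • _) ?_
  rcases l with l | k
  · fin_cases l
    · exact hR.a₁₁_eq hξ
    · exact hR.a₁₂_eq hξ
  · rfl

lemma IsMovingFrame.sum_A_one (F : IsMovingFrame f ν U) (hξ : ξ ∈ U) :
    ∑ l, A f (T₁ f) (T₂ f) (T₁₂ f) ν ξ (Sum.inl 1) l • frame (T₁ f) (T₂ f) ν l ξ = T₁₂ f ξ := by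
  have hR := F.regular
  rw [← (F.at hξ).expand (Z := T₁₂ f ξ) trace_T₁₂]
  simp only [frame_apply]
  refine Finset.sum_congr rfl fun l _ => congrArg (· • _) ?_
  rcases l with l | k
  · fin_cases l <;> simp [coef, A, hR.ip_T₁₂_T₁ hξ, hR.ip_T₁₂_T₂ hξ]
  · rfl

/-- The bottom rows of `A` presuppose `(∂ν_j, T₂) = -H_j`. The missing multiple of `(W, ν_j)`
changes only the tangential coefficients, so the error is tangent. -/
lemma IsMovingFrame.sum_A_inr (F : IsMovingFrame f ν U) (hξ : ξ ∈ U) (j) :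
    ∑ l, A f (T₁ f) (T₂ f) (T₁₂ f) ν ξ (Sum.inr j) l • frame (T₁ f) (T₂ f) ν l ξ =
      dzM (ν j) ξ + (Complex.I * ip (W f ξ) (ν j ξ) * (metricDet (T₁ f) (T₂ f) ξ)⁻¹) •
        (ip (T₁ f ξ) (T₁ f ξ) • T₂ f ξ - ip (T₁ f ξ) (T₂ f ξ) • T₁ f ξ) := by
  have hR := F.regular
  have ht : (dzM (ν j) ξ).trace = 0 := by
    rw [dzM_eq]
    exact trace_dW_eq_zero hR hξ _ (F.smν hξ j) fun ζ hζ => (F.normal.mem j ζ hζ).2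
  conv_rhs => rw [← (F.at hξ).expand ht]
  simp only [frame_apply]
  rw [sum_vframe, sum_vframe]
  have h1 := F.ip_dν_T₁ hξ j
  have h2 := F.ip_dν_T₂ hξ j
  have e0 : A f (T₁ f) (T₂ f) (T₁₂ f) ν ξ (Sum.inr j) (Sum.inl 0) =
      coef (T₁ f ξ) (T₂ f ξ) (fun k => ν k ξ) (dzM (ν j) ξ) (Sum.inl 0) -
      Complex.I * ip (W f ξ) (ν j ξ) * (metricDet (T₁ f) (T₂ f) ξ)⁻¹ * ip (T₁ f ξ) (T₂ f ξ) := by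
    simp only [A, coef, Matrix.fromBlocks_apply₂₁, Matrix.of_apply, Matrix.cons_val_zero,
      Sum.elim_inl, h1, h2, metricDet]
    ring
  have e1 : A f (T₁ f) (T₂ f) (T₁₂ f) ν ξ (Sum.inr j) (Sum.inl 1) =
      coef (T₁ f ξ) (T₂ f ξ) (fun k => ν k ξ) (dzM (ν j) ξ) (Sum.inl 1) +
      Complex.I * ip (W f ξ) (ν j ξ) * (metricDet (T₁ f) (T₂ f) ξ)⁻¹ * ip (T₁ f ξ) (T₁ f ξ) := by
    simp only [A, coef, Matrix.fromBlocks_apply₂₁, Matrix.of_apply, Matrix.cons_val_one,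
      Matrix.cons_val_fin_one, Sum.elim_inl, h1, h2, metricDet]
    ring
  have e2 : ∀ k, A f (T₁ f) (T₂ f) (T₁₂ f) ν ξ (Sum.inr j) (Sum.inr k) =
      coef (T₁ f ξ) (T₂ f ξ) (fun k => ν k ξ) (dzM (ν j) ξ) (Sum.inr k) := fun k => rfl
  simp only [e0, e1, e2]
  module

/-- The discrepancy in the equations `∂η = A η`. -/
def defectA (f : ℂ → Fin (N + 1) → ℂ) (ν : Fin (N * (N + 2) - 2) → ℂ → Mat N) (i : Idx N)
    (ξ : ℂ) : Mat N :=
  ∑ l, A f (T₁ f) (T₂ f) (T₁₂ f) ν ξ i l • frame (T₁ f) (T₂ f) ν l ξ -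
    dzM (frame (T₁ f) (T₂ f) ν i) ξ

/-- The discrepancy in the equations `∂̄η = B η`. -/
def defectB (f : ℂ → Fin (N + 1) → ℂ) (ν : Fin (N * (N + 2) - 2) → ℂ → Mat N) (i : Idx N)
    (ξ : ℂ) : Mat N :=
  ∑ l, B f (T₁ f) (T₂ f) (T₁₂ f) ν ξ i l • frame (T₁ f) (T₂ f) ν l ξ -
    dzbM (frame (T₁ f) (T₂ f) ν i) ξ

/-- The three types of defect are zero, `-iW` and a combination of `T₁` and `T₂`; all are
off-diagonal. -/
lemma IsMovingFrame.sandwich_defectA (F : IsMovingFrame f ν U) (hξ : ξ ∈ U) (i : Idx N) :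
    P f ξ * defectA f ν i ξ * P f ξ = 0 := by
  have h0 := F.regular.ne_zero ξ hξ
  rcases i with i | k
  · fin_cases i
    · have : defectA f ν (Sum.inl 0) ξ = 0 := by
        rw [defectA, F.sum_A_zero hξ]; exact sub_self _
      simp only [Fin.zero_eta, this, mul_zero, zero_mul]
    · have : defectA f ν (Sum.inl 1) ξ = -(Complex.I • W f ξ) := by
        rw [defectA, F.sum_A_one hξ]
        change T₁₂ f ξ - dzM (T₂ f) ξ = _
        rw [F.regular.dzM_T₂ hξ]
        abel
      simp only [Fin.mk_one, this, mul_neg, neg_mul, Matrix.mul_smul, Matrix.smul_mul,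
        sandwich_W h0, smul_zero, neg_zero]
  · have : defectA f ν (Sum.inr k) ξ = (Complex.I * ip (W f ξ) (ν k ξ) *
        (metricDet (T₁ f) (T₂ f) ξ)⁻¹) •
        (ip (T₁ f ξ) (T₁ f ξ) • T₂ f ξ - ip (T₁ f ξ) (T₂ f ξ) • T₁ f ξ) := by
      rw [defectA, F.sum_A_inr hξ]; exact add_sub_cancel_left _ _
    simp only [this, Matrix.mul_smul, Matrix.smul_mul, mul_sub, sub_mul, sandwich_T₁ h0,
      sandwich_T₂ h0, smul_zero, sub_zero]

lemma IsMovingFrame.defectA_eq_zero (F : IsMovingFrame f ν U) (hξ : ξ ∈ U) (hW : W f ξ = 0)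
    (i : Idx N) : defectA f ν i ξ = 0 := by
  rcases i with i | k
  · fin_cases i
    · rw [defectA]
      exact sub_eq_zero.2 (F.sum_A_zero hξ)
    · rw [defectA]
      refine sub_eq_zero.2 ((F.sum_A_one hξ).trans ?_)
      change T₁₂ f ξ = dzM (T₂ f) ξ
      rw [F.regular.dzM_T₂ hξ, hW, smul_zero, add_zero]
  · rw [defectA]
    refine sub_eq_zero.2 ((F.sum_A_inr hξ k).trans ?_)
    rw [hW, ip_zero_left, mul_zero, zero_mul, zero_smul, add_zero]
    rfl

/-- The involution of the index set exchanging the two tangent indices. -/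
def swapIdx (N : ℕ) : Idx N ≃ Idx N := Equiv.sumCongr (Equiv.swap 0 1) (Equiv.refl _)

lemma swapIdx_swapIdx (i : Idx N) : swapIdx N (swapIdx N i) = i := by
  rcases i with i | k
  · simp [swapIdx]
  · rfl

lemma IsMovingFrame.frame_conjTranspose (F : IsMovingFrame f ν U) (hξ : ξ ∈ U) (i : Idx N) :
    (frame (T₁ f) (T₂ f) ν i ξ)ᴴ = -frame (T₁ f) (T₂ f) ν (swapIdx N i) ξ := by
  rcases i with i | k
  · fin_cases i
    · exact T₁_conjTranspose
    · exact T₂_conjTranspose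
  · exact (F.normal.mem k ξ hξ).1

lemma IsMovingFrame.star_Hn (F : IsMovingFrame f ν U) (hξ : ξ ∈ U) (k) :
    star (Hn (T₁₂ f) ν ξ k) = Hn (T₁₂ f) ν ξ k := by
  rw [Hn, star_ip, T₁₂_conjTranspose, (F.normal.mem k ξ hξ).1, ip_neg_left, ip_neg_right, neg_neg]

/-- The adjoint maps `T₁` to `-T₂` and each normal to its negative. So `B` is the conjugate of `A`
with the two tangent indices exchanged, and all facts about `B` follow from those about `A`. -/
lemma IsMovingFrame.B_eq (F : IsMovingFrame f ν U) (hξ : ξ ∈ U) (i l : Idx N) :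
    B f (T₁ f) (T₂ f) (T₁₂ f) ν ξ i l =
      star (A f (T₁ f) (T₂ f) (T₁₂ f) ν ξ (swapIdx N i) (swapIdx N l)) := by
  have hH := F.star_Hn hξ
  have h2 : star (ip (T₂ f ξ) (T₂ f ξ)) = ip (T₁ f ξ) (T₁ f ξ) := by
    rw [← star_metric₁₁, star_star]
  rcases i with i | j <;> rcases l with l | k
  · fin_cases i <;> fin_cases l <;> simp [A, B, swapIdx]
  · fin_cases i
    · exact (hH k).symm
    · rfl
  · have := hH j
    fin_cases l
    · simp only [A, B, swapIdx, Equiv.sumCongr_apply, Sum.map_inl, Sum.map_inr, Fin.zero_eta,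
        Equiv.swap_apply_left, Matrix.fromBlocks_apply₂₁, Matrix.of_apply, Matrix.cons_val_zero,
        Matrix.cons_val_one, Matrix.cons_val_fin_one, Equiv.refl_apply, star_mul', star_sub,
        star_inv₀, star_metricDet, star_metric₁₁, star_metric₁₂, this]
    · simp only [A, B, swapIdx, Equiv.sumCongr_apply, Sum.map_inl, Sum.map_inr, Fin.mk_one,
        Equiv.swap_apply_right, Matrix.fromBlocks_apply₂₁, Matrix.of_apply, Matrix.cons_val_zero,
        Matrix.cons_val_one, Matrix.cons_val_fin_one, Equiv.refl_apply, star_mul', star_sub,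
        star_inv₀, star_metricDet, h2, star_metric₁₂, this]
  · rfl

lemma dzbM_dzM {Z : ℂ → Mat N} (hZ : SmM Z ξ) : dzbM (dzM Z) ξ = dzM (dzbM Z) ξ := by
  rw [dzM_eq, dzbM_eq, dWM_comm _ _ hZ]

lemma IsMovingFrame.dzbM_frame (F : IsMovingFrame f ν U) (hξ : ξ ∈ U) (i : Idx N) :
    dzbM (frame (T₁ f) (T₂ f) ν i) ξ = -(dzM (frame (T₁ f) (T₂ f) ν (swapIdx N i)) ξ)ᴴ := by
  have h : frame (T₁ f) (T₂ f) ν i =ᶠ[nhds ξ]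
      fun ζ => -(frame (T₁ f) (T₂ f) ν (swapIdx N i) ζ)ᴴ :=
    F.regular.eventually hξ fun ζ hζ => by
      simp only [F.frame_conjTranspose hζ, neg_neg, swapIdx_swapIdx]
  rw [dzbM_eq, dzM_eq, dWM_congr _ h, dWM_neg, dWM_conjTranspose]
  simp

lemma IsMovingFrame.defectB_eq (F : IsMovingFrame f ν U) (hξ : ξ ∈ U) (i : Idx N) :
    defectB f ν i ξ = -(defectA f ν (swapIdx N i) ξ)ᴴ := by
  rw [defectA, defectB, F.dzbM_frame hξ, Matrix.conjTranspose_sub, Matrix.conjTranspose_sum,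
    ← (swapIdx N).sum_comp (fun l => (A f (T₁ f) (T₂ f) (T₁₂ f) ν ξ (swapIdx N i) l •
      frame (T₁ f) (T₂ f) ν l ξ)ᴴ)]
  simp only [Matrix.conjTranspose_smul, ← F.B_eq hξ, F.frame_conjTranspose hξ, swapIdx_swapIdx,
    smul_neg, Finset.sum_neg_distrib]
  abel

lemma IsMovingFrame.sandwich_defectB (F : IsMovingFrame f ν U) (hξ : ξ ∈ U) (i : Idx N) :
    P f ξ * defectB f ν i ξ * P f ξ = 0 := by
  have h := congrArg Matrix.conjTranspose (F.sandwich_defectA hξ (swapIdx N i))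
  rw [Matrix.conjTranspose_mul, Matrix.conjTranspose_mul, P_conjTranspose,
    Matrix.conjTranspose_zero, ← mul_assoc] at h
  rw [F.defectB_eq hξ, mul_neg, neg_mul, h, neg_zero]

lemma IsMovingFrame.defectB_eq_zero (F : IsMovingFrame f ν U) (hξ : ξ ∈ U) (hW : W f ξ = 0)
    (i : Idx N) : defectB f ν i ξ = 0 := by
  rw [F.defectB_eq hξ, F.defectA_eq_zero hξ hW, Matrix.conjTranspose_zero, neg_zero]

lemma IsMovingFrame.sum_B_zero (F : IsMovingFrame f ν U) (hξ : ξ ∈ U) :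
    ∑ l, B f (T₁ f) (T₂ f) (T₁₂ f) ν ξ (Sum.inl 0) l • frame (T₁ f) (T₂ f) ν l ξ = T₁₂ f ξ := by
  have h := congrArg Matrix.conjTranspose (F.sum_A_one hξ)
  rw [Matrix.conjTranspose_sum, T₁₂_conjTranspose, ← (swapIdx N).sum_comp (fun l =>
    (A f (T₁ f) (T₂ f) (T₁₂ f) ν ξ (Sum.inl 1) l • frame (T₁ f) (T₂ f) ν l ξ)ᴴ)] at h
  have hB : ∀ l, B f (T₁ f) (T₂ f) (T₁₂ f) ν ξ (Sum.inl 0) l =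
      star (A f (T₁ f) (T₂ f) (T₁₂ f) ν ξ (Sum.inl 1) (swapIdx N l)) := F.B_eq hξ (Sum.inl 0)
  simp only [Matrix.conjTranspose_smul, ← hB, F.frame_conjTranspose hξ, swapIdx_swapIdx,
    smul_neg, Finset.sum_neg_distrib, neg_inj] at h
  exact h

lemma Regular.sm_metricDet (R : Regular f U) (hξ : ξ ∈ U) :
    ContDiffAt ℝ ∞ (metricDet (T₁ f) (T₂ f)) ξ :=
  (((R.smT₁ hξ).ip (R.smT₁ hξ)).mul ((R.smT₂ hξ).ip (R.smT₂ hξ))).sub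
    (((R.smT₁ hξ).ip (R.smT₂ hξ)).pow 2)

lemma IsMovingFrame.smA (F : IsMovingFrame f ν U) (hξ : ξ ∈ U) :
    SmM (A f (T₁ f) (T₂ f) (T₁₂ f) ν) ξ := by
  have R := F.regular
  have s₁ := R.smT₁ hξ
  have s₂ := R.smT₂ hξ
  have sd : SmM (dzM (T₁ f)) ξ := by rw [dzM_eq]; exact s₁.dW _
  have sg : ContDiffAt ℝ ∞ (fun ζ => (metricDet (T₁ f) (T₂ f) ζ)⁻¹) ξ :=
    (R.sm_metricDet hξ).inv (F.det_ne ξ hξ)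
  have sJ : ∀ k, ContDiffAt ℝ ∞ (fun ζ => Jn (T₁ f) ν ζ k) ξ := fun k => sd.ip (F.smν hξ k)
  have sH : ∀ k, ContDiffAt ℝ ∞ (fun ζ => Hn (T₁₂ f) ν ζ k) ξ := fun k =>
    (R.smT₁₂ hξ).ip (F.smν hξ k)
  intro i l
  rcases i with i | j <;> rcases l with l | k
  · fin_cases i <;> fin_cases l
    -- Smoothness is read off from the Cramer form of the coefficient rather than from its
    -- expression in `f`.
    · exact ContDiffAt.congr_of_eventuallyEq
        (sg.mul (((sd.ip s₁).mul (s₂.ip s₂)).sub ((sd.ip s₂).mul (s₁.ip s₂))))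
        (R.eventually hξ fun _ hζ => R.a₁₁_eq hζ)
    · exact ContDiffAt.congr_of_eventuallyEq
        (sg.mul (((sd.ip s₂).mul (s₁.ip s₁)).sub ((sd.ip s₁).mul (s₁.ip s₂))))
        (R.eventually hξ fun _ hζ => R.a₁₂_eq hζ)
    · exact contDiffAt_const (c := (0 : ℂ))
    · exact contDiffAt_const (c := (0 : ℂ))
  · fin_cases i
    · exact sJ k
    · exact sH k
  · fin_cases l
    · exact sg.mul (((sH j).mul (s₁.ip s₂)).sub ((sJ j).mul (s₂.ip s₂)))
    · exact sg.mul (((sJ j).mul (s₁.ip s₂)).sub ((sH j).mul (s₁.ip s₁)))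
  · have sν : SmM (dzM (ν j)) ξ := by rw [dzM_eq]; exact (F.smν hξ j).dW _
    exact sν.ip (F.smν hξ k)

lemma IsMovingFrame.smB (F : IsMovingFrame f ν U) (hξ : ξ ∈ U) :
    SmM (B f (T₁ f) (T₂ f) (T₁₂ f) ν) ξ := fun i l =>
  (smooth_star (F.smA hξ (swapIdx N i) (swapIdx N l))).congr_of_eventuallyEq
    (F.regular.eventually hξ fun _ hζ => F.B_eq hζ i l)

lemma IsMovingFrame.gaussWeingarten (F : IsMovingFrame f ν U) (hW : ∀ ξ ∈ U, W f ξ = 0) :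
    GaussWeingarten (frame (T₁ f) (T₂ f) ν) (A f (T₁ f) (T₂ f) (T₁₂ f) ν)
      (B f (T₁ f) (T₂ f) (T₁₂ f) ν) U := fun ξ hξ i =>
  ⟨(sub_eq_zero.1 (F.defectA_eq_zero hξ (hW ξ hξ) i)).symm,
    (sub_eq_zero.1 (F.defectB_eq_zero hξ (hW ξ hξ) i)).symm⟩

/-- When `W = 0` the defects vanish, the curvature applied to the frame is `∂̄∂η - ∂∂̄η = 0`, and
the frame is independent. -/
lemma IsMovingFrame.gaussCodazziRicci (F : IsMovingFrame f ν U) (hW : ∀ ξ ∈ U, W f ξ = 0) :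
    GaussCodazziRicci (A f (T₁ f) (T₂ f) (T₁₂ f) ν) (B f (T₁ f) (T₂ f) (T₁₂ f) ν) U := by
  intro ξ hξ
  ext i l
  have hGW := F.gaussWeingarten hW
  have h := sum_curvature (F.smFrame hξ) (F.smA hξ) (F.smB hξ) i
  have hA : ∀ k, ∑ l, A f (T₁ f) (T₂ f) (T₁₂ f) ν ξ k l • frame (T₁ f) (T₂ f) ν l ξ -
      dzM (frame (T₁ f) (T₂ f) ν k) ξ = 0 := F.defectA_eq_zero hξ (hW ξ hξ)
  have hB : ∀ k, ∑ l, B f (T₁ f) (T₂ f) (T₁₂ f) ν ξ k l • frame (T₁ f) (T₂ f) ν l ξ -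
      dzbM (frame (T₁ f) (T₂ f) ν k) ξ = 0 := F.defectB_eq_zero hξ (hW ξ hξ)
  simp only [hA, hB, smul_zero, Finset.sum_const_zero, add_zero, sub_zero] at h
  have e1 : dzbM (fun ζ => ∑ l, A f (T₁ f) (T₂ f) (T₁₂ f) ν ζ i l • frame (T₁ f) (T₂ f) ν l ζ) ξ =
      dzbM (dzM (frame (T₁ f) (T₂ f) ν i)) ξ :=
    dWM_congr _ (F.regular.eventually hξ fun ζ hζ => (hGW ζ hζ i).1.symm)
  have e2 : dzM (fun ζ => ∑ l, B f (T₁ f) (T₂ f) (T₁₂ f) ν ζ i l • frame (T₁ f) (T₂ f) ν l ζ) ξ =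
      dzM (dzbM (frame (T₁ f) (T₂ f) ν i)) ξ := by
    rw [dzM_eq]
    exact dWM_congr _ (F.regular.eventually hξ fun ζ hζ => (hGW ζ hζ i).2.symm)
  rw [e1, e2, dzbM_dzM (F.smFrame hξ i), sub_self] at h
  exact Fintype.linearIndependent_iff.1 (F.linearIndependent hξ) _ h l

/-- The first row suffices: there `Aη` is exactly `∂T₁` and `Bη` is exactly `T₁₂`, so the derivative
terms leave `-i∂W`. -/
lemma IsMovingFrame.W_eq_zero (F : IsMovingFrame f ν U)
    (hC : GaussCodazziRicci (A f (T₁ f) (T₂ f) (T₁₂ f) ν) (B f (T₁ f) (T₂ f) (T₁₂ f) ν) U)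
    (hξ : ξ ∈ U) : W f ξ = 0 := by
  have R := F.regular
  apply R.W_eq_zero_of_sandwich hξ (F.det_ne ξ hξ)
  have h := sum_curvature (F.smFrame hξ) (F.smA hξ) (F.smB hξ) (Sum.inl 0)
  have e1 : dzbM (fun ζ => ∑ l, A f (T₁ f) (T₂ f) (T₁₂ f) ν ζ (Sum.inl 0) l •
      frame (T₁ f) (T₂ f) ν l ζ) ξ = dzM (T₁₂ f) ξ - Complex.I • dzM (W f) ξ := by
    rw [dzM_eq, ← dWM_const_smul _ _ (R.smW hξ),
      ← dWM_sub _ (R.smT₁₂ hξ) ((R.smW hξ).const_smul _), dzbM_eq,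
      dWM_congr _ (R.eventually hξ fun ζ hζ => F.sum_A_zero hζ), dzM_eq,
      dWM_comm _ _ (R.smT₁ hξ)]
    exact dWM_congr _ (R.eventually hξ fun ζ hζ => R.dzbM_T₁ hζ)
  have e2 : dzM (fun ζ => ∑ l, B f (T₁ f) (T₂ f) (T₁₂ f) ν ζ (Sum.inl 0) l •
      frame (T₁ f) (T₂ f) ν l ζ) ξ = dzM (T₁₂ f) ξ := by
    rw [dzM_eq]
    exact dWM_congr _ (R.eventually hξ fun ζ hζ => F.sum_B_zero hζ)
  rw [hC ξ hξ, e1, e2] at h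
  simp only [Matrix.zero_apply, zero_smul, Finset.sum_const_zero] at h
  change 0 = _ + ∑ l, _ • defectB f ν l ξ - ∑ l, _ • defectA f ν l ξ at h
  -- The coefficients of the defects are not needed: `Z ↦ PZP` kills every defect and isolates `P ∂W
  -- P`.
  have h2 := congrArg (fun Z => P f ξ * Z * P f ξ) h
  simp only [mul_add, mul_sub, add_mul, sub_mul, Finset.mul_sum, Finset.sum_mul, Matrix.mul_smul,
    Matrix.smul_mul, F.sandwich_defectA hξ, F.sandwich_defectB hξ, smul_zero, mul_zero, zero_mul,
    Finset.sum_const_zero, add_zero, sub_zero] at h2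
  have h3 : Complex.I • (P f ξ * dzM (W f) ξ * P f ξ) = 0 := by
    rw [sub_sub_cancel_left] at h2
    exact neg_eq_zero.1 h2.symm
  exact (smul_eq_zero.1 h3).resolve_left Complex.I_ne_zero

lemma IsMovingFrame.gaussCodazziRicci_iff (F : IsMovingFrame f ν U) :
    GaussCodazziRicci (A f (T₁ f) (T₂ f) (T₁₂ f) ν) (B f (T₁ f) (T₂ f) (T₁₂ f) ν) U ↔
      IsSolution f U := by
  rw [F.regular.isSolution_iff]
  exact ⟨fun h ξ hξ => F.W_eq_zero h hξ, F.gaussCodazziRicci⟩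

end Structure

/-! ### Existence of the surface. -/

section Surface

variable {N : ℕ} {f : ℂ → Fin (N + 1) → ℂ} {U : Set ℂ} {ξ : ℂ}

/-- The real linear map `x ↦ a x + b x̄`. -/
def wirtinger (a b : ℂ) : ℂ →L[ℝ] ℂ :=
  a • ContinuousLinearMap.id ℝ ℂ + b • (Complex.conjCLE : ℂ →L[ℝ] ℂ)

lemma wirtinger_apply (a b x : ℂ) : wirtinger a b x = a * x + b * star x := by
  simp [wirtinger]

lemma dW_of_hasFDerivAt {h : ℂ → ℂ} {a b : ℂ} (hh : HasFDerivAt h (wirtinger a b) ξ) (c : ℂ) :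
    dW c h ξ = (1 / 2) * ((a + b) + c * (a * Complex.I - b * Complex.I)) := by
  rw [dW, hh.fderiv, wirtinger_apply, wirtinger_apply]
  simp [sub_eq_add_neg]

lemma dz_of_hasFDerivAt {h : ℂ → ℂ} {a b : ℂ} (hh : HasFDerivAt h (wirtinger a b) ξ) :
    dz h ξ = a := by
  rw [dz_eq, dW_of_hasFDerivAt hh]
  linear_combination ((b - a) / 2) * Complex.I_mul_I

lemma dzb_of_hasFDerivAt {h : ℂ → ℂ} {a b : ℂ} (hh : HasFDerivAt h (wirtinger a b) ξ) :
    dzb h ξ = b := by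
  rw [dzb_eq, dW_of_hasFDerivAt hh]
  linear_combination ((a - b) / 2) * Complex.I_mul_I

lemma fderiv_apply_eq (h : ℂ → ℂ) (ξ x : ℂ) :
    fderiv ℝ h ξ x = dz h ξ * x + dzb h ξ * star x := by
  have hx : x = x.re • (1 : ℂ) + x.im • Complex.I := by simp
  conv_lhs => rw [hx, map_add, map_smul, map_smul]
  have hs : star x = (x.re : ℂ) - x.im * Complex.I := by
    apply Complex.ext <;> simp
  have hx' : x = (x.re : ℂ) + x.im * Complex.I := (Complex.re_add_im x).symm
  rw [hs]
  conv_rhs => rw [hx']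
  simp only [dz, dzb, Complex.real_smul, Complex.add_re, Complex.ofReal_re, Complex.mul_re,
    Complex.I_re, Complex.I_im, Complex.ofReal_im, Complex.add_im, Complex.mul_im, mul_zero,
    mul_one, zero_add, add_zero, sub_zero]
  linear_combination ((x.im : ℂ) * fderiv ℝ h ξ Complex.I) * Complex.I_mul_I

/-- A closed form `a dξ + b dξ̄` on an open convex set is exact. -/
lemma exists_primitive {D : Set ℂ} (hD : Convex ℝ D) (hDo : IsOpen D) {a b : ℂ → ℂ}
    (ha : ∀ ξ ∈ D, ContDiffAt ℝ ∞ a ξ) (hb : ∀ ξ ∈ D, ContDiffAt ℝ ∞ b ξ)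
    (hab : ∀ ξ ∈ D, dzb a ξ = dz b ξ) :
    ∃ h : ℂ → ℂ, ∀ ξ ∈ D, HasFDerivAt h (wirtinger (a ξ) (b ξ)) ξ := by
  have hω : ∀ ξ ∈ D, HasFDerivAt (fun ζ => wirtinger (a ζ) (b ζ))
      ((fderiv ℝ a ξ).smulRight (ContinuousLinearMap.id ℝ ℂ) +
        (fderiv ℝ b ξ).smulRight (Complex.conjCLE : ℂ →L[ℝ] ℂ)) ξ := fun ξ hξ =>
    ((diffAt (ha ξ hξ)).hasFDerivAt.smul_const (ContinuousLinearMap.id ℝ ℂ)).add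
      ((diffAt (hb ξ hξ)).hasFDerivAt.smul_const (Complex.conjCLE : ℂ →L[ℝ] ℂ))
  -- Poincaré lemma on a convex set; symmetry of the derivative of the form is `∂̄a = ∂b`.
  refine hD.exists_forall_hasFDerivAt_of_fderiv_symmetric hDo
    (fun ξ hξ => (hω ξ hξ).differentiableAt.differentiableWithinAt) fun ξ hξ x y => ?_
  rw [(hω ξ hξ).fderiv]
  simp only [add_apply, ContinuousLinearMap.smulRight_apply, smul_apply,
    ContinuousLinearMap.id_apply, ContinuousLinearEquiv.coe_coe, Complex.conjCLE_apply,
    smul_eq_mul, fderiv_apply_eq, hab ξ hξ, Complex.star_def]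
  ring

lemma isSurface_iff {X : ℂ → Mat N} : IsSurface f X U ↔ (∀ ξ ∈ U, X ξ ∈ su N) ∧
    ∀ ξ ∈ U, ∀ i j, HasFDerivAt (fun ζ => X ζ i j) (wirtinger (T₁ f ξ i j) (T₂ f ξ i j)) ξ :=
  ⟨fun h => ⟨h.mem, h.hasFDerivAt⟩, fun h => ⟨h.1, h.2⟩⟩

lemma IsSurface.dzM_eq {X : ℂ → Mat N} (h : IsSurface f X U) (hξ : ξ ∈ U) :
    dzM X ξ = T₁ f ξ := by
  ext i j
  exact dz_of_hasFDerivAt ((isSurface_iff.1 h).2 ξ hξ i j)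

lemma IsSurface.dzbM_eq {X : ℂ → Mat N} (h : IsSurface f X U) (hξ : ξ ∈ U) :
    dzbM X ξ = T₂ f ξ := by
  ext i j
  exact dzb_of_hasFDerivAt ((isSurface_iff.1 h).2 ξ hξ i j)

/-- The projection of a complex matrix onto `su(N+1)`. -/
def suPart (X : Mat N) : Mat N :=
  (1 / 2 : ℂ) • (X - Xᴴ) - ((1 / 2 : ℂ) * (N + 1 : ℂ)⁻¹ * (X - Xᴴ).trace) • 1

lemma suPart_mem (X : Mat N) : suPart X ∈ su N := by
  constructor
  · simp only [suPart, Matrix.conjTranspose_sub, Matrix.conjTranspose_smul,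
      Matrix.conjTranspose_conjTranspose, Matrix.conjTranspose_one, star_mul', star_inv₀,
      Matrix.trace_sub, Matrix.trace_conjTranspose, star_sub, star_star, star_add, star_one,
      star_natCast, star_div₀, star_ofNat]
    module
  · have : (N + 1 : ℂ) ≠ 0 := by exact_mod_cast Nat.succ_ne_zero N
    simp only [suPart, Matrix.trace_sub, Matrix.trace_smul, Matrix.trace_one, Fintype.card_fin,
      smul_eq_mul]
    push_cast
    field_simp
    ring

/-- Entrywise primitives need not lie in `su(N+1)`. Since the form takes values there on real
tangent vectors, `suPart` corrects them without changing the differential. -/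
lemma exists_isSurface (R : Regular f U) (hU : Convex ℝ U) (hW : ∀ ξ ∈ U, W f ξ = 0) :
    ∃ X : ℂ → Mat N, IsSurface f X U := by
  have hex : ∀ i j, ∃ h : ℂ → ℂ, ∀ ξ ∈ U,
      HasFDerivAt h (wirtinger (T₁ f ξ i j) (T₂ f ξ i j)) ξ := fun i j => by
    refine exists_primitive hU R.isOpen (fun ξ hξ => R.smT₁ hξ i j) (fun ξ hξ => R.smT₂ hξ i j)
      fun ξ hξ => ?_
    have h1 := R.dzM_T₂ hξ
    have h2 := R.dzbM_T₁ hξ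
    rw [hW ξ hξ, smul_zero] at h1 h2
    rw [add_zero] at h1
    rw [sub_zero] at h2
    exact congrFun (congrFun (h2.trans h1.symm) i) j
  choose h hh using hex
  have hskew : ∀ ξ ∈ U, ∀ i j, HasFDerivAt (fun ζ => h i j ζ - star (h j i ζ))
      (wirtinger (2 * T₁ f ξ i j) (2 * T₂ f ξ i j)) ξ := fun ξ hξ i j => by
    refine ((hh i j ξ hξ).sub ((Complex.conjCLE : ℂ →L[ℝ] ℂ).hasFDerivAt.comp ξ
      (hh j i ξ hξ))).congr_fderiv ?_
    have e1 : star (T₁ f ξ j i) = -T₂ f ξ i j :=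
      congrFun (congrFun (T₁_conjTranspose (f := f) (ξ := ξ)) i) j
    have e2 : star (T₂ f ξ j i) = -T₁ f ξ i j :=
      congrFun (congrFun (T₂_conjTranspose (f := f) (ξ := ξ)) i) j
    ext x
    simp only [sub_apply, ContinuousLinearMap.comp_apply, wirtinger_apply,
      ContinuousLinearEquiv.coe_coe, Complex.conjCLE_apply, ← Complex.star_def, star_add,
      star_mul', e1, e2, star_star]
    ring
  let X₀ : ℂ → Mat N := fun ζ => Matrix.of fun i j => h i j ζ
  refine ⟨fun ζ => suPart (X₀ ζ), isSurface_iff.2 ⟨fun ξ _ => suPart_mem _, fun ξ hξ i j => ?_⟩⟩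
  -- The trace removed by `suPart` is locally constant because `T₁` and `T₂` are traceless.
  have htr : HasFDerivAt (fun ζ => (X₀ ζ - (X₀ ζ)ᴴ).trace) (0 : ℂ →L[ℝ] ℂ) ξ := by
    have := HasFDerivAt.fun_sum (u := Finset.univ) fun i _ => hskew ξ hξ i i
    refine this.congr_fderiv ?_
    have t1 : ∑ i, T₁ f ξ i i = 0 := trace_T₁
    have t2 : ∑ i, T₂ f ξ i i = 0 := trace_T₂
    ext x
    simp only [sum_apply, wirtinger_apply, Finset.sum_add_distrib, ← Finset.sum_mul,
      ← Finset.mul_sum, t1, t2]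
    simp
  refine (((hskew ξ hξ i j).const_mul (1 / 2)).sub
    ((htr.const_mul ((1 / 2 : ℂ) * (N + 1 : ℂ)⁻¹)).mul_const ((1 : Mat N) i j))).congr_fderiv ?_
  ext x
  simp only [sub_apply, smul_apply, wirtinger_apply, smul_zero, zero_apply, smul_eq_mul]
  ring

end Surface

open scoped RealInnerProductSpace

/-! ### Smooth orthonormal frames of orthogonal complements. -/

section Householder

variable {V : Type*} [NormedAddCommGroup V] [InnerProductSpace ℝ V]

/-- The reflection in the hyperplane orthogonal to `d`. -/
def householder (d w : V) : V := w - (2 * ⟪d, w⟫ / ⟪d, d⟫) • d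

lemma inner_householder (d v w : V) : ⟪householder d v, householder d w⟫ = ⟪v, w⟫ := by
  -- For `d = 0` division by zero makes `householder d` the identity.
  by_cases hd : d = 0
  · simp [householder, hd]
  have h : ⟪d, d⟫ ≠ 0 := inner_self_ne_zero.2 hd
  simp only [householder, inner_sub_left, inner_sub_right, real_inner_smul_left,
    real_inner_smul_right, real_inner_comm d v]
  field_simp
  ring

lemma householder_householder (d w : V) : householder d (householder d w) = w := by
  by_cases hd : d = 0
  · simp [householder, hd]
  have h : ⟪d, d⟫ ≠ 0 := inner_self_ne_zero.2 hd
  simp only [householder, inner_sub_right, real_inner_smul_right]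
  rw [sub_sub, ← add_smul]
  have : 2 * ⟪d, w⟫ / ⟪d, d⟫ + 2 * (⟪d, w⟫ - 2 * ⟪d, w⟫ / ⟪d, d⟫ * ⟪d, d⟫) / ⟪d, d⟫ = 0 := by
    field_simp
    ring
  rw [this, zero_smul, sub_zero]

/-- The reflection along `u - c` exchanges the unit vectors `u` and `c`. It depends smoothly on `u`
away from `c`, so it carries a fixed basis of `c^⊥` to a smooth frame of `u^⊥`. -/
lemma householder_sub {u c : V} (hu : ⟪u, u⟫ = 1) (hc : ⟪c, c⟫ = 1) (h : u ≠ c) :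
    householder (u - c) c = u := by
  have hd : ⟪u - c, u - c⟫ ≠ 0 := inner_self_ne_zero.2 (sub_ne_zero.2 h)
  have e : 2 * ⟪u - c, c⟫ = -⟪u - c, u - c⟫ := by
    simp only [inner_sub_left, inner_sub_right, hu, hc, real_inner_comm u c]
    ring
  rw [householder, e, neg_div, div_self hd]
  simp

lemma householder_smul (d w : V) (s : ℝ) : householder d (s • w) = s • householder d w := by
  simp only [householder, real_inner_smul_right, smul_sub, smul_smul]
  congr 2
  ring

end Householder

section GeneralPosition

variable {V : Type*} [NormedAddCommGroup V] [InnerProductSpace ℝ V] [FiniteDimensional ℝ V]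

/-- In dimension at least four there is a vector on none of the lines spanned by the values of a
smooth map on a convex plane domain. -/
lemma exists_forall_ne_smul (hV : 3 < Module.finrank ℝ V) {D : Set ℂ} (hD : Convex ℝ D)
    {x : ℂ → V} (hx : ContDiffOn ℝ ∞ x D) : ∃ c : V, ∀ ξ ∈ D, ∀ s : ℝ, c ≠ s • x ξ := by
  have h1 : ContDiffOn ℝ 1 (fun p : ℂ × ℝ => p.2 • x p.1) (D ×ˢ Set.univ) :=
    contDiffOn_snd.smul ((hx.of_le (by simp)).comp contDiffOn_fst fun p hp => hp.1)
  -- The cone over the image of `x` is the `C¹` image of a set of dimension at most 3, so its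
  -- complement is dense in `V`.
  have hdim : dimH (D ×ˢ (Set.univ : Set ℝ)) < Module.finrank ℝ V := by
    refine (dimH_mono (Set.subset_univ _)).trans_lt ?_
    rw [Real.dimH_univ_eq_finrank]
    simpa using hV
  have hd := h1.dense_compl_image_of_dimH_lt_finrank (hD.prod convex_univ) subset_rfl hdim
  obtain ⟨c, hc⟩ := hd.nonempty
  exact ⟨c, fun ξ hξ s hs => hc ⟨(ξ, s), ⟨hξ, Set.mem_univ _⟩, hs.symm⟩⟩

end GeneralPosition

section NormalFields

/-- A nowhere vanishing field over a convex plane domain has a smooth orthonormal frame of its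
orthogonal complement. -/
lemma exists_frame_orthogonal_one {m : ℕ} (hm : 3 ≤ m) {D : Set ℂ} (hD : Convex ℝ D)
    {x : ℂ → EuclideanSpace ℝ (Fin (m + 1))} (hx : ContDiffOn ℝ ∞ x D) (h0 : ∀ ξ ∈ D, x ξ ≠ 0) :
    ∃ e : Fin m → ℂ → EuclideanSpace ℝ (Fin (m + 1)), (∀ k, ContDiffOn ℝ ∞ (e k) D) ∧
      ∀ ξ ∈ D, Orthonormal ℝ (fun k => e k ξ) ∧ (∀ k, ⟪x ξ, e k ξ⟫ = 0) ∧
        ∀ z, (∀ k, ⟪e k ξ, z⟫ = 0) → ∃ s : ℝ, z = s • x ξ := by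
  rcases D.eq_empty_or_nonempty with rfl | ⟨ξ₀, hξ₀⟩
  · exact ⟨fun _ _ => 0, fun _ => contDiffOn_const, by simp⟩
  obtain ⟨c, hc⟩ := exists_forall_ne_smul (V := EuclideanSpace ℝ (Fin (m + 1)))
    (by simp; omega) hD hx
  -- The value `s = 0` of the general position statement.
  have hc0 : c ≠ 0 := by simpa using hc ξ₀ hξ₀ 0
  have hcn : ‖c‖ ≠ 0 := norm_ne_zero_iff.2 hc0
  set c₁ : EuclideanSpace ℝ (Fin (m + 1)) := ‖c‖⁻¹ • c with hc₁
  have hc₁0 : c₁ ≠ 0 := smul_ne_zero (inv_ne_zero hcn) hc0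
  have hc₁1 : ⟪c₁, c₁⟫ = 1 := by
    rw [hc₁, real_inner_smul_left, real_inner_smul_right, real_inner_self_eq_norm_sq]
    field_simp
  set u : ℂ → EuclideanSpace ℝ (Fin (m + 1)) := fun ξ => ‖x ξ‖⁻¹ • x ξ with hu
  have hu1 : ∀ ξ ∈ D, ⟪u ξ, u ξ⟫ = 1 := fun ξ hξ => by
    have := norm_ne_zero_iff.2 (h0 ξ hξ)
    rw [hu, real_inner_smul_left, real_inner_smul_right, real_inner_self_eq_norm_sq]
    field_simp
  have hus : ContDiffOn ℝ ∞ u D :=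
    ((hx.norm ℝ h0).inv fun ξ hξ => norm_ne_zero_iff.2 (h0 ξ hξ)).smul hx
  have huc : ∀ ξ ∈ D, u ξ ≠ c₁ := fun ξ hξ h => by
    apply hc ξ hξ (‖c‖ * ‖x ξ‖⁻¹)
    rw [mul_smul]
    change c = ‖c‖ • u ξ
    rw [h, hc₁, smul_smul, mul_inv_cancel₀ hcn, one_smul]
  have : Fact (Module.finrank ℝ (EuclideanSpace ℝ (Fin (m + 1))) = m + 1) := ⟨by simp⟩
  let b := OrthonormalBasis.fromOrthogonalSpanSingleton (𝕜 := ℝ) m hc₁0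
  have hbc : ∀ k, ⟪c₁, (b k : EuclideanSpace ℝ (Fin (m + 1)))⟫ = 0 := fun k =>
    Submodule.mem_orthogonal_singleton_iff_inner_right.1 (b k).2
  have hxu : ∀ ξ ∈ D, x ξ = ‖x ξ‖ • u ξ := fun ξ hξ => by
    rw [hu, smul_smul, mul_inv_cancel₀ (norm_ne_zero_iff.2 (h0 ξ hξ)), one_smul]
  refine ⟨fun k ξ => householder (u ξ - c₁) (b k), fun k => ?_, fun ξ hξ => ⟨?_, fun k => ?_, ?_⟩⟩
  · have hd : ContDiffOn ℝ ∞ (fun ξ => u ξ - c₁) D := hus.sub contDiffOn_const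
    exact contDiffOn_const.sub (((contDiffOn_const.mul (hd.inner ℝ contDiffOn_const)).div
      (hd.inner ℝ hd) fun ξ hξ => inner_self_ne_zero.2 (sub_ne_zero.2 (huc ξ hξ))).smul hd)
  · rw [orthonormal_iff_ite]
    intro i j
    rw [inner_householder]
    exact orthonormal_iff_ite.1 b.orthonormal i j
  · rw [hxu ξ hξ, real_inner_smul_left]
    conv_lhs => rw [← householder_sub (hu1 ξ hξ) hc₁1 (huc ξ hξ), inner_householder]
    rw [hbc, mul_zero]
  · intro z hz
    have h1 : ∀ k, ⟪(b k : EuclideanSpace ℝ (Fin (m + 1))), householder (u ξ - c₁) z⟫ = 0 := by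
      intro k
      rw [← hz k, ← inner_householder (u ξ - c₁), householder_householder]
    -- The reflected `z` is orthogonal to a basis of `c₁^⊥`, hence a multiple of `c₁`; reflecting
    -- back makes `z` a multiple of `u`.
    have h2 : householder (u ξ - c₁) z ∈ (Submodule.span ℝ {c₁})ᗮᗮ := by
      rw [Submodule.mem_orthogonal]
      intro w hw
      have hr := b.sum_repr ⟨w, hw⟩
      have hr' := congrArg Subtype.val hr
      simp only [Submodule.coe_sum, Submodule.coe_smul] at hr'
      rw [← hr', sum_inner]
      exact Finset.sum_eq_zero fun k _ => by rw [real_inner_smul_left, h1 k, mul_zero]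
    rw [Submodule.orthogonal_orthogonal, Submodule.mem_span_singleton] at h2
    obtain ⟨s, hs⟩ := h2
    refine ⟨s * ‖x ξ‖⁻¹, ?_⟩
    rw [mul_smul]
    change z = s • u ξ
    rw [← householder_householder (u ξ - c₁) z, ← hs, householder_smul,
      householder_sub (hu1 ξ hξ) hc₁1 (huc ξ hξ)]

end NormalFields

section NormalPlane

/-- This is the case `N = 1`, where `su(2)` has dimension three and general position gives nothing;
the normalised cross product is the normal. -/
lemma exists_frame_orthogonal_cross {D : Set ℂ}
    {x y : ℂ → EuclideanSpace ℝ (Fin 3)} (hx : ContDiffOn ℝ ∞ x D)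
    (hy : ContDiffOn ℝ ∞ y D) (h0 : ∀ ξ ∈ D, x ξ ≠ 0) (h1 : ∀ ξ ∈ D, ∀ s : ℝ, y ξ ≠ s • x ξ) :
    ∃ e : Fin 1 → ℂ → EuclideanSpace ℝ (Fin 3), (∀ k, ContDiffOn ℝ ∞ (e k) D) ∧
      ∀ ξ ∈ D, Orthonormal ℝ (fun k => e k ξ) ∧ (∀ k, ⟪x ξ, e k ξ⟫ = 0) ∧
        (∀ k, ⟪y ξ, e k ξ⟫ = 0) := by
  set w : ℂ → EuclideanSpace ℝ (Fin 3) := fun ξ =>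
    WithLp.toLp 2 (crossProduct (x ξ).ofLp (y ξ).ofLp) with hw
  have hxi := contDiffOn_euclidean.1 hx
  have hyi := contDiffOn_euclidean.1 hy
  have hws : ContDiffOn ℝ ∞ w D := by
    refine contDiffOn_euclidean.2 fun i => ?_
    simp only [hw, cross_apply]
    fin_cases i
    · exact ((hxi 1).mul (hyi 2)).sub ((hxi 2).mul (hyi 1))
    · exact ((hxi 2).mul (hyi 0)).sub ((hxi 0).mul (hyi 2))
    · exact ((hxi 0).mul (hyi 1)).sub ((hxi 1).mul (hyi 0))
  have hw0 : ∀ ξ ∈ D, w ξ ≠ 0 := fun ξ hξ h => by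
    have hc : crossProduct (x ξ).ofLp (y ξ).ofLp = 0 := congrArg WithLp.ofLp h
    have hx0 : (x ξ).ofLp ≠ 0 := fun h => h0 ξ hξ (congrArg (WithLp.toLp 2) h)
    have := mt (crossProduct_ne_zero_iff_linearIndependent (v := (x ξ).ofLp) (w := (y ξ).ofLp)).2
      (not_not.2 hc)
    rw [LinearIndependent.pair_iff' hx0] at this
    push Not at this
    obtain ⟨s, hs⟩ := this
    exact h1 ξ hξ s (congrArg (WithLp.toLp 2) hs.symm)
  have hxw : ∀ ξ, ⟪x ξ, w ξ⟫ = 0 := fun ξ => by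
    rw [EuclideanSpace.inner_eq_star_dotProduct, star_trivial, dotProduct_comm]
    exact dot_self_cross _ _
  have hyw : ∀ ξ, ⟪y ξ, w ξ⟫ = 0 := fun ξ => by
    rw [EuclideanSpace.inner_eq_star_dotProduct, star_trivial, dotProduct_comm]
    exact dot_cross_self _ _
  refine ⟨fun _ ξ => ‖w ξ‖⁻¹ • w ξ, fun _ =>
    ((hws.norm ℝ hw0).inv fun ξ hξ => norm_ne_zero_iff.2 (hw0 ξ hξ)).smul hws,
    fun ξ hξ => ⟨?_, fun _ => ?_, fun _ => ?_⟩⟩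
  · rw [orthonormal_iff_ite]
    intro i j
    have := norm_ne_zero_iff.2 (hw0 ξ hξ)
    rw [Subsingleton.elim i j, if_pos rfl, real_inner_smul_left, real_inner_smul_right,
      real_inner_self_eq_norm_sq]
    field_simp
  · rw [real_inner_smul_right, hxw, mul_zero]
  · rw [real_inner_smul_right, hyw, mul_zero]

/-- A plane field over a convex plane domain has a smooth orthonormal frame of its orthogonal
complement. -/
lemma exists_frame_orthogonal_two {m : ℕ} (hm : m = 1 ∨ 3 ≤ m) {D : Set ℂ} (hD : Convex ℝ D)
    {x y : ℂ → EuclideanSpace ℝ (Fin (m + 2))} (hx : ContDiffOn ℝ ∞ x D)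
    (hy : ContDiffOn ℝ ∞ y D) (h0 : ∀ ξ ∈ D, x ξ ≠ 0) (h1 : ∀ ξ ∈ D, ∀ s : ℝ, y ξ ≠ s • x ξ) :
    ∃ e : Fin m → ℂ → EuclideanSpace ℝ (Fin (m + 2)), (∀ k, ContDiffOn ℝ ∞ (e k) D) ∧
      ∀ ξ ∈ D, Orthonormal ℝ (fun k => e k ξ) ∧ (∀ k, ⟪x ξ, e k ξ⟫ = 0) ∧
        (∀ k, ⟪y ξ, e k ξ⟫ = 0) := by
  rcases hm with rfl | hm
  · exact exists_frame_orthogonal_cross hx hy h0 h1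
  obtain ⟨e, he, hep⟩ := exists_frame_orthogonal_one (m := m + 1) (by omega) hD hx h0
  -- The coordinates of `y` in the frame of `x^⊥`, nonzero because `y` is not on the line of `x`.
  -- The one-vector case is applied again, now in dimension `m + 1 ≥ 4`.
  set z : ℂ → EuclideanSpace ℝ (Fin (m + 1)) := fun ξ =>
    WithLp.toLp 2 fun k => ⟪e k ξ, y ξ⟫ with hz
  have hzs : ContDiffOn ℝ ∞ z D := contDiffOn_euclidean.2 fun k => (he k).inner ℝ hy
  have hz0 : ∀ ξ ∈ D, z ξ ≠ 0 := fun ξ hξ h => by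
    obtain ⟨s, hs⟩ := (hep ξ hξ).2.2 (y ξ) fun k => congrFun (congrArg WithLp.ofLp h) k
    exact h1 ξ hξ s hs
  obtain ⟨d, hd, hdp⟩ := exists_frame_orthogonal_one hm hD hzs hz0
  refine ⟨fun l ξ => ∑ k, d l ξ k • e k ξ, fun l => ?_, fun ξ hξ => ⟨?_, fun l => ?_, fun l => ?_⟩⟩
  · exact ContDiffOn.sum fun k _ => (contDiffOn_euclidean.1 (hd l) k).smul (he k)
  · rw [orthonormal_iff_ite]
    intro i j
    rw [(hep ξ hξ).1.inner_sum, ← orthonormal_iff_ite.1 (hdp ξ hξ).1 i j]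
    simp [PiLp.inner_apply, mul_comm]
  · rw [inner_sum]
    exact Finset.sum_eq_zero fun k _ => by
      rw [real_inner_smul_right, (hep ξ hξ).2.1 k, mul_zero]
  · rw [inner_sum, ← (hdp ξ hξ).2.1 l, PiLp.inner_apply (z ξ)]
    refine Finset.sum_congr rfl fun k _ => ?_
    rw [real_inner_smul_right, real_inner_comm]
    rfl

end NormalPlane

/-! ### `su(N+1)` as a Euclidean space. -/

section LieAlgebra

variable {N : ℕ}

/-- The real vector space `su(N+1)`. -/
def suR (N : ℕ) : Submodule ℝ (Mat N) where
  carrier := su N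
  add_mem' := fun {X Y} hX hY => ⟨by rw [Matrix.conjTranspose_add, hX.1, hY.1]; abel,
    by rw [Matrix.trace_add, hX.2, hY.2, add_zero]⟩
  zero_mem' := ⟨by simp, by simp⟩
  smul_mem' := fun r X hX => ⟨by rw [Matrix.conjTranspose_smul, hX.1, star_trivial, smul_neg],
    by rw [Matrix.trace_smul, hX.2, smul_zero]⟩

lemma star_ip_of_mem {X Y : Mat N} (hX : X ∈ su N) (hY : Y ∈ su N) : star (ip X Y) = ip X Y := by
  rw [star_ip, hX.1, hY.1, ip_neg_left, ip_neg_right, neg_neg]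

lemma ofReal_re_ip {X Y : Mat N} (hX : X ∈ su N) (hY : Y ∈ su N) :
    ((ip X Y).re : ℂ) = ip X Y := Complex.conj_eq_iff_re.1 (star_ip_of_mem hX hY)

lemma ip_self_re {X : Mat N} (hX : X ∈ su N) :
    (ip X X).re = ∑ i, ∑ j, Complex.normSq (X i j) := by
  have h : ∀ i j, X j i = -star (X i j) := fun i j => by
    have := congrFun (congrFun hX.1 j) i
    rw [Matrix.conjTranspose_apply, Matrix.neg_apply] at this
    rw [this, neg_neg]
  simp only [ip, Matrix.trace, Matrix.diag_apply, Matrix.mul_apply, Complex.neg_re, Complex.re_sum,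
    ← Finset.sum_neg_distrib]
  refine Finset.sum_congr rfl fun i _ => Finset.sum_congr rfl fun j _ => ?_
  rw [h i j, mul_neg, Complex.neg_re, neg_neg, Complex.star_def, Complex.mul_conj,
    Complex.ofReal_re]

lemma eq_zero_of_ip_self_re {X : Mat N} (hX : X ∈ su N) (h : (ip X X).re = 0) : X = 0 := by
  rw [ip_self_re hX] at h
  ext i j
  have h1 := (Finset.sum_eq_zero_iff_of_nonneg fun i _ => Finset.sum_nonneg fun j _ =>
    Complex.normSq_nonneg (X i j)).1 h i (Finset.mem_univ _)
  exact Complex.normSq_eq_zero.1 ((Finset.sum_eq_zero_iff_of_nonneg fun j _ =>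
    Complex.normSq_nonneg (X i j)).1 h1 j (Finset.mem_univ _))

/-- The inner product of `su(N+1)`. -/
@[reducible]
def suCore (N : ℕ) : InnerProductSpace.Core ℝ (suR N) where
  inner X Y := (ip X.1 Y.1).re
  conj_inner_symm X Y := by simp [ip_comm X.1]
  re_inner_nonneg X := by
    change 0 ≤ (ip X.1 X.1).re
    rw [ip_self_re X.2]
    exact Finset.sum_nonneg fun i _ => Finset.sum_nonneg fun j _ => Complex.normSq_nonneg _
  add_left X Y Z := by simp [ip_add_left]
  smul_left X Y r := by
    have : ip (r • X.1) Y.1 = (r : ℂ) * ip X.1 Y.1 := by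
      rw [← ip_smul_left]; rfl
    simp [this]
  definite X h := by
    change (ip X.1 X.1).re = 0 at h
    exact Subtype.ext (eq_zero_of_ip_self_re X.2 h)

/-- The decomposition `sl(N+1) = su(N+1) ⊕ i su(N+1)`. -/
def suProdEquiv (N : ℕ) : (suR N × suR N) ≃ₗ[ℝ] sl N where
  toFun p := ⟨p.1.1 + Complex.I • p.2.1, by
    rw [mem_sl, Matrix.trace_add, Matrix.trace_smul, p.1.2.2, p.2.2.2]; simp⟩
  map_add' p q := by
    ext1
    simp only [Prod.fst_add, Prod.snd_add, Submodule.coe_add, smul_add]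
    abel
  map_smul' r p := by
    ext1
    simp only [Prod.smul_fst, Prod.smul_snd, Submodule.coe_smul, RingHom.id_apply,
      Submodule.coe_smul_of_tower, smul_add, smul_comm Complex.I r]
  invFun Z := (⟨(1 / 2 : ℂ) • (Z.1 - Z.1ᴴ), by
      have h := mem_sl.1 Z.2
      refine ⟨?_, ?_⟩
      · simp only [Matrix.conjTranspose_smul, Matrix.conjTranspose_sub,
          Matrix.conjTranspose_conjTranspose, star_div₀, star_one, star_ofNat]
        module
      · simp [Matrix.trace_sub, Matrix.trace_conjTranspose, h]⟩,
    ⟨(-Complex.I / 2) • (Z.1 + Z.1ᴴ), by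
      have h := mem_sl.1 Z.2
      refine ⟨?_, ?_⟩
      · simp only [Matrix.conjTranspose_smul, Matrix.conjTranspose_add,
          Matrix.conjTranspose_conjTranspose, star_div₀, star_neg, star_ofNat, Complex.star_def,
          Complex.conj_I]
        module
      · simp [Matrix.trace_add, Matrix.trace_conjTranspose, h]⟩)
  left_inv p := by
    have h1 : p.1.1ᴴ = -p.1.1 := p.1.2.1
    have h2 : p.2.1ᴴ = -p.2.1 := p.2.2.1
    ext1 <;> ext1
    · simp only [Matrix.conjTranspose_add, Matrix.conjTranspose_smul, h1, h2, Complex.star_def,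
        Complex.conj_I]
      module
    · simp only [Matrix.conjTranspose_add, Matrix.conjTranspose_smul, h1, h2, Complex.star_def,
        Complex.conj_I]
      have hI : -Complex.I / 2 * Complex.I = 1 / 2 := by
        linear_combination (-1 / 2) * Complex.I_mul_I
      simp only [smul_add, smul_neg, smul_smul, hI, mul_neg]
      module
  right_inv Z := by
    ext1
    have hI : Complex.I * (-Complex.I / 2) = 1 / 2 := by
      linear_combination (-1 / 2) * Complex.I_mul_I
    simp only [smul_smul, hI]
    module

/-- `sl(N+1)` is the complexification of `su(N+1)`, so real dimensions differ by a factor of two. -/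
lemma finrank_suR (N : ℕ) : Module.finrank ℝ (suR N) = N * (N + 2) := by
  have h1 := (suProdEquiv N).finrank_eq
  rw [Module.finrank_prod] at h1
  have h2 := finrank_real_of_complex (sl N)
  rw [finrank_sl] at h2
  omega

lemma exists_su_basis (N : ℕ) {n : ℕ} (hn : n = N * (N + 2)) : ∃ b : Fin n → Mat N,
    (∀ k, b k ∈ su N) ∧ (∀ j k, ip (b j) (b k) = if j = k then 1 else 0) ∧
      ∀ Z ∈ su N, (∀ k, (ip Z (b k)).re = 0) → Z = 0 := by
  let _ : InnerProductSpace.Core ℝ (suR N) := suCore N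
  let _ : NormedAddCommGroup (suR N) := InnerProductSpace.Core.toNormedAddCommGroup (𝕜 := ℝ)
  let _ : InnerProductSpace ℝ (suR N) := InnerProductSpace.ofCore (suCore N).toCore
  have hfr : Module.finrank ℝ (suR N) = n := by rw [finrank_suR, hn]
  let b := (stdOrthonormalBasis ℝ (suR N)).reindex (finCongr hfr)
  refine ⟨fun k => (b k).1, fun k => (b k).2, fun j k => ?_, fun Z hZ h => ?_⟩
  · have h : (ip (b j).1 (b k).1).re = if j = k then 1 else 0 :=
      orthonormal_iff_ite.1 b.orthonormal j k
    rw [← ofReal_re_ip (b j).2 (b k).2, h]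
    split_ifs <;> simp
  · have hs := b.sum_repr' ⟨Z, hZ⟩
    have h0 : ∀ k, ⟪b k, (⟨Z, hZ⟩ : suR N)⟫ = 0 := fun k => by
      rw [real_inner_comm]; exact h k
    simp only [h0, zero_smul, Finset.sum_const_zero] at hs
    exact congrArg Subtype.val hs.symm

end LieAlgebra

/-! ### Existence of the normal frame. -/

section Existence

variable {N : ℕ} {f : ℂ → Fin (N + 1) → ℂ} {U : Set ℂ} {ξ : ℂ}

lemma metricDet_smul_smul {E₁ E₂ : ℂ → Mat N} {Z : Mat N} {a b : ℂ} (h₁ : E₁ ξ = a • Z)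
    (h₂ : E₂ ξ = b • Z) : metricDet E₁ E₂ ξ = 0 := by
  simp only [metricDet, h₁, h₂, ip_smul_left, ip_smul_right]; ring

lemma exists_isNormalFrame (R : Regular f U) (hU : Convex ℝ U) (hne : U.Nonempty)
    (hg : ∀ ξ ∈ U, metricDet (T₁ f) (T₂ f) ξ ≠ 0) : ∃ ν, IsNormalFrame (T₁ f) (T₂ f) ν U := by
  obtain ⟨ξ₀, hξ₀⟩ := hne
  have hN : 1 ≤ N := one_le_of_det_ne (E₂ := T₂ f ξ₀) trace_T₁ (hg ξ₀ hξ₀)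
  -- The number of normals is 1 for `N = 1` and at least 6 otherwise, so the uncovered value 2 never
  -- occurs.
  have hm : N * (N + 2) - 2 = 1 ∨ 3 ≤ N * (N + 2) - 2 := by
    rcases hN.eq_or_lt with rfl | h
    · left; rfl
    · right
      have : 8 ≤ N * (N + 2) := Nat.mul_le_mul h (by omega : 4 ≤ N + 2)
      omega
  have hn : N * (N + 2) - 2 + 2 = N * (N + 2) := by omega
  obtain ⟨m, hmdef⟩ : ∃ m, m = N * (N + 2) - 2 := ⟨_, rfl⟩
  rw [← hmdef] at hm hn
  obtain ⟨b, hb, hbo, hbz⟩ := exists_su_basis N hn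
  -- The real tangent fields: for a surface `X`, these are `∂₁X` and `∂₂X`. Their linear dependence
  -- over `ℝ` would make `T₁` and `T₂` proportional to one matrix and `g` zero.
  set X₁ : ℂ → Mat N := fun ξ => T₁ f ξ + T₂ f ξ with hX₁
  set X₂ : ℂ → Mat N := fun ξ => Complex.I • (T₁ f ξ - T₂ f ξ) with hX₂
  have m₁ : ∀ ξ, X₁ ξ ∈ su N := fun ξ => ⟨by
    rw [hX₁, Matrix.conjTranspose_add, T₁_conjTranspose, T₂_conjTranspose, neg_add_rev], by
    rw [hX₁, Matrix.trace_add, trace_T₁, trace_T₂, add_zero]⟩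
  have m₂ : ∀ ξ, X₂ ξ ∈ su N := fun ξ => ⟨by
    simp only [hX₂, Matrix.conjTranspose_smul, Matrix.conjTranspose_sub, T₁_conjTranspose,
      T₂_conjTranspose, Complex.star_def, Complex.conj_I]
    module, by
    rw [hX₂, Matrix.trace_smul, Matrix.trace_sub, trace_T₁, trace_T₂, sub_zero, smul_zero]⟩
  have s₁ : ∀ ξ ∈ U, SmM X₁ ξ := fun ξ hξ => (R.smT₁ hξ).add (R.smT₂ hξ)
  have s₂ : ∀ ξ ∈ U, SmM X₂ ξ := fun ξ hξ => ((R.smT₁ hξ).sub (R.smT₂ hξ)).const_smul _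
  have hT₁ : ∀ ξ, T₁ f ξ = (1 / 2 : ℂ) • X₁ ξ + (-Complex.I / 2) • X₂ ξ := fun ξ => by
    have hI : -Complex.I / 2 * Complex.I = 1 / 2 := by
      linear_combination (-1 / 2) * Complex.I_mul_I
    simp only [hX₁, hX₂, smul_smul, hI]
    module
  have hT₂ : ∀ ξ, T₂ f ξ = (1 / 2 : ℂ) • X₁ ξ + (Complex.I / 2) • X₂ ξ := fun ξ => by
    have hI : Complex.I / 2 * Complex.I = -1 / 2 := by
      linear_combination (1 / 2) * Complex.I_mul_I
    simp only [hX₁, hX₂, smul_smul, hI]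
    module
  let coord : (ℂ → Mat N) → ℂ → EuclideanSpace ℝ (Fin (m + 2)) := fun X ξ =>
    WithLp.toLp 2 fun k => (ip (X ξ) (b k)).re
  have hcs : ∀ X : ℂ → Mat N, (∀ ξ ∈ U, SmM X ξ) → ContDiffOn ℝ ∞ (coord X) U := fun X hX =>
    contDiffOn_euclidean.2 fun k ξ hξ => (Complex.reCLM.contDiff.contDiffAt.comp ξ
      ((hX ξ hξ).ip (SmM.const (b k)))).contDiffWithinAt
  have hx0 : ∀ ξ ∈ U, coord X₁ ξ ≠ 0 := fun ξ hξ h => by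
    have h0 : X₁ ξ = 0 := hbz _ (m₁ ξ) fun k => congrFun (congrArg WithLp.ofLp h) k
    refine hg ξ hξ (metricDet_smul_smul (Z := X₂ ξ) (a := -Complex.I / 2) (b := Complex.I / 2) ?_ ?_)
    · rw [hT₁, h0, smul_zero, zero_add]
    · rw [hT₂, h0, smul_zero, zero_add]
  have hy0 : ∀ ξ ∈ U, ∀ s : ℝ, coord X₂ ξ ≠ s • coord X₁ ξ := fun ξ hξ s h => by
    have h0 : X₂ ξ - s • X₁ ξ = 0 := by
      refine hbz _ ((suR N).sub_mem (m₂ ξ) ((suR N).smul_mem s (m₁ ξ))) fun k => ?_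
      have hk : (ip (X₂ ξ) (b k)).re = s * (ip (X₁ ξ) (b k)).re :=
        congrFun (congrArg WithLp.ofLp h) k
      have hs : ip (s • X₁ ξ) (b k) = (s : ℂ) * ip (X₁ ξ) (b k) := by
        rw [← ip_smul_left]; rfl
      rw [ip_sub_left, hs, Complex.sub_re, Complex.re_ofReal_mul, hk, sub_self]
    have h1 : X₂ ξ = (s : ℂ) • X₁ ξ := sub_eq_zero.1 h0
    refine hg ξ hξ (metricDet_smul_smul (Z := X₁ ξ) (a := 1 / 2 + -Complex.I / 2 * s)
      (b := 1 / 2 + Complex.I / 2 * s) ?_ ?_)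
    · rw [hT₁, h1, smul_smul, add_smul]
    · rw [hT₂, h1, smul_smul, add_smul]
  obtain ⟨e, he, hep⟩ := exists_frame_orthogonal_two hm hU (hcs X₁ s₁) (hcs X₂ s₂) hx0 hy0
  have key : ∀ X : ℂ → Mat N, ∀ ξ, X ξ ∈ su N → ∀ k, ⟪coord X ξ, e k ξ⟫ = 0 →
      ip (X ξ) (∑ l, (e k ξ l : ℂ) • b l) = 0 := fun X ξ hX k h => by
    rw [ip_comm, ip_sum_left]
    rw [PiLp.inner_apply] at h
    have h' : ∑ l, e k ξ l * (ip (X ξ) (b l)).re = 0 := h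
    rw [← Complex.ofReal_zero, ← h', Complex.ofReal_sum]
    refine Finset.sum_congr rfl fun l _ => ?_
    rw [ip_smul_left, ip_comm, Complex.ofReal_mul, ofReal_re_ip hX (hb l)]
  subst hmdef
  refine ⟨fun k ξ => ∑ l, (e k ξ l : ℂ) • b l, ?_, ?_, ?_, ?_, ?_⟩
  · intro k i j
    simp only [Matrix.sum_apply, Matrix.smul_apply, smul_eq_mul]
    exact ContDiffOn.sum fun l _ => (Complex.ofRealCLM.contDiff.comp_contDiffOn
      (contDiffOn_euclidean.1 (he k) l)).mul contDiffOn_const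
  · intro k ξ _
    exact (suR N).sum_mem fun l _ => (suR N).smul_mem (e k ξ l) (hb l)
  · intro k ξ hξ
    rw [hT₁, ip_add_left, ip_smul_left, ip_smul_left, key X₁ ξ (m₁ ξ) k ((hep ξ hξ).2.1 k),
      key X₂ ξ (m₂ ξ) k ((hep ξ hξ).2.2 k), mul_zero, mul_zero, add_zero]
  · intro k ξ hξ
    rw [hT₂, ip_add_left, ip_smul_left, ip_smul_left, key X₁ ξ (m₁ ξ) k ((hep ξ hξ).2.1 k),
      key X₂ ξ (m₂ ξ) k ((hep ξ hξ).2.2 k), mul_zero, mul_zero, add_zero]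
  · intro j k ξ hξ
    have h := orthonormal_iff_ite.1 (hep ξ hξ).1 j k
    rw [PiLp.inner_apply] at h
    have h' : ∑ l, e k ξ l * e j ξ l = if j = k then 1 else 0 := h
    have h2 : ∀ l, ip (b l) (∑ l, (e k ξ l : ℂ) • b l) = e k ξ l := fun l => by
      rw [ip_comm, ip_sum_left]
      simp only [ip_smul_left, hbo, mul_ite, mul_one, mul_zero, Finset.sum_ite_eq',
        Finset.mem_univ, if_true]
    rw [ip_sum_left]
    simp only [ip_smul_left, h2]
    rw [Finset.sum_congr rfl fun l _ => mul_comm _ _]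
    have h3 := congrArg (fun r : ℝ => (r : ℂ)) h'
    simp only [Complex.ofReal_sum, Complex.ofReal_mul] at h3
    rw [h3]
    split_ifs <;> simp

end Existence

/-! ### Transfer between fields that agree on an open set, such as `∂X` and `iK†` on the disc. -/

section Congruence

variable {N : ℕ} {U : Set ℂ} {ξ : ℂ} {E₁ E₂ M E₁' E₂' M' : ℂ → Mat N}
  {ν : Fin (N * (N + 2) - 2) → ℂ → Mat N}

lemma metricDet_congr (h₁ : Set.EqOn E₁ E₁' U) (h₂ : Set.EqOn E₂ E₂' U) (hξ : ξ ∈ U) :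
    metricDet E₁ E₂ ξ = metricDet E₁' E₂' ξ := by
  simp only [metricDet, h₁ hξ, h₂ hξ]

lemma frame_congr (h₁ : Set.EqOn E₁ E₁' U) (h₂ : Set.EqOn E₂ E₂' U) (i : Idx N) :
    Set.EqOn (frame E₁ E₂ ν i) (frame E₁' E₂' ν i) U := fun ξ hξ => by
  rw [frame_apply, frame_apply, h₁ hξ, h₂ hξ]

lemma IsNormalFrame.congr (h₁ : Set.EqOn E₁ E₁' U) (h₂ : Set.EqOn E₂ E₂' U)
    (h : IsNormalFrame E₁ E₂ ν U) : IsNormalFrame E₁' E₂' ν U :=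
  ⟨h.smooth, h.mem, fun k ξ hξ => by rw [← h₁ hξ]; exact h.orth₁ k ξ hξ,
    fun k ξ hξ => by rw [← h₂ hξ]; exact h.orth₂ k ξ hξ, h.orthonormal⟩

lemma dzM_eqOn {m n : Type*} (hU : IsOpen U) {Z Z' : ℂ → Matrix m n ℂ} (h : Set.EqOn Z Z' U) :
    Set.EqOn (dzM Z) (dzM Z') U := fun ξ hξ => by
  rw [dzM_eq]
  exact dWM_congr _ (Filter.eventuallyEq_of_mem (hU.mem_nhds hξ) h)

lemma dzbM_eqOn {m n : Type*} (hU : IsOpen U) {Z Z' : ℂ → Matrix m n ℂ} (h : Set.EqOn Z Z' U) :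
    Set.EqOn (dzbM Z) (dzbM Z') U := fun _ hξ =>
  dWM_congr _ (Filter.eventuallyEq_of_mem (hU.mem_nhds hξ) h)

variable (f : ℂ → Fin (N + 1) → ℂ)

lemma A_congr (hU : IsOpen U) (h₁ : Set.EqOn E₁ E₁' U) (h₂ : Set.EqOn E₂ E₂' U)
    (h : Set.EqOn M M' U) : Set.EqOn (A f E₁ E₂ M ν) (A f E₁' E₂' M' ν) U := fun ξ hξ => by
  simp only [A, a₁₁, a₁₂, Jn, Hn, metricDet, h₁ hξ, h₂ hξ, h hξ, dzM_eqOn hU h₁ hξ]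

lemma B_congr (hU : IsOpen U) (h₁ : Set.EqOn E₁ E₁' U) (h₂ : Set.EqOn E₂ E₂' U)
    (h : Set.EqOn M M' U) : Set.EqOn (B f E₁ E₂ M ν) (B f E₁' E₂' M' ν) U := fun ξ hξ => by
  simp only [B, a₁₁, a₁₂, Jn, Hn, metricDet, h₁ hξ, h₂ hξ, h hξ, dzM_eqOn hU h₁ hξ]

lemma GaussWeingarten.congr (hU : IsOpen U) {η η' : Idx N → ℂ → Mat N}
    {a b a' b' : ℂ → Matrix (Idx N) (Idx N) ℂ} (hη : ∀ i, Set.EqOn (η i) (η' i) U)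
    (ha : Set.EqOn a a' U) (hb : Set.EqOn b b' U) (h : GaussWeingarten η a b U) :
    GaussWeingarten η' a' b' U := fun ξ hξ i => by
  have := h ξ hξ i
  rw [dzM_eqOn hU (hη i) hξ, dzbM_eqOn hU (hη i) hξ, ha hξ, hb hξ] at this
  simpa only [fun l => hη l hξ] using this

lemma GaussCodazziRicci.congr (hU : IsOpen U) {a b a' b' : ℂ → Matrix (Idx N) (Idx N) ℂ}
    (ha : Set.EqOn a a' U) (hb : Set.EqOn b b' U) (h : GaussCodazziRicci a b U) :
    GaussCodazziRicci a' b' U := fun ξ hξ => by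
  have := h ξ hξ
  rwa [dzbM_eqOn hU ha hξ, dzM_eqOn hU hb hξ, ha hξ, hb hξ] at this

end Congruence

lemma regular_of_contDiffOn {N : ℕ} {Ω : Set ℂ} (hΩ : IsOpen Ω) {f : ℂ → Fin (N + 1) → ℂ}
    (hf : ContDiffOn ℝ ∞ f Ω) (hf0 : ∀ ξ ∈ Ω, f ξ ≠ 0) {U : Set ℂ} (hU : IsOpen U) (hUΩ : U ⊆ Ω) :
    Regular f U where
  isOpen := hU
  smooth _ hξ i := contDiffAt_pi.1 (hf.contDiffAt (hΩ.mem_nhds (hUΩ hξ))) i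
  ne_zero ξ hξ := hf0 ξ (hUΩ hξ)

end CPN

end

theorem mainTheorem1 (N : ℕ) (Ω : Set ℂ) (hΩ : IsOpen Ω) (f : ℂ → Fin (N + 1) → ℂ)
    (hf : ContDiffOn ℝ ∞ f Ω) (hf0 : ∀ ξ ∈ Ω, f ξ ≠ 0) :
    (CPN.IsSolution f Ω → ∀ (p : ℂ) (r : ℝ), 0 < r → Metric.ball p r ⊆ Ω →
      (∃ X : ℂ → CPN.Mat N, CPN.IsSurface f X (Metric.ball p r)) ∧
      ∀ X : ℂ → CPN.Mat N, CPN.IsSurface f X (Metric.ball p r) →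
        (∀ ξ ∈ Metric.ball p r, CPN.metricDet (CPN.dzM X) (CPN.dzbM X) ξ ≠ 0) →
        (∃ ν, CPN.IsNormalFrame (CPN.dzM X) (CPN.dzbM X) ν (Metric.ball p r)) ∧
        ∀ ν, CPN.IsNormalFrame (CPN.dzM X) (CPN.dzbM X) ν (Metric.ball p r) →
          (∀ ξ ∈ Metric.ball p r, LinearIndependent ℂ
            (fun i => CPN.frame (CPN.dzM X) (CPN.dzbM X) ν i ξ)) ∧
          CPN.GaussWeingarten (CPN.frame (CPN.dzM X) (CPN.dzbM X) ν)
            (CPN.A f (CPN.dzM X) (CPN.dzbM X) (CPN.dzM (CPN.dzbM X)) ν)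
            (CPN.B f (CPN.dzM X) (CPN.dzbM X) (CPN.dzM (CPN.dzbM X)) ν) (Metric.ball p r) ∧
          (∀ ξ ∈ Metric.ball p r, ∀ j k, CPN.S ν ξ j k + CPN.S ν ξ k j = 0) ∧
          CPN.GaussCodazziRicci
            (CPN.A f (CPN.dzM X) (CPN.dzbM X) (CPN.dzM (CPN.dzbM X)) ν)
            (CPN.B f (CPN.dzM X) (CPN.dzbM X) (CPN.dzM (CPN.dzbM X)) ν) (Metric.ball p r)) ∧
    (∀ U : Set ℂ, IsOpen U → U ⊆ Ω →
      (∀ ξ ∈ U, CPN.metricDet (CPN.T₁ f) (CPN.T₂ f) ξ ≠ 0) →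
      ∀ ν, CPN.IsNormalFrame (CPN.T₁ f) (CPN.T₂ f) ν U →
        (CPN.GaussCodazziRicci
            (CPN.A f (CPN.T₁ f) (CPN.T₂ f) (CPN.T₁₂ f) ν)
            (CPN.B f (CPN.T₁ f) (CPN.T₂ f) (CPN.T₁₂ f) ν) U ↔
          CPN.IsSolution f U)) := by
  refine ⟨fun hsol p r hr hball => ?_, fun U hU hUΩ hg ν hν =>
    CPN.IsMovingFrame.gaussCodazziRicci_iff
      ⟨CPN.regular_of_contDiffOn hΩ hf hf0 hU hUΩ, hg, hν⟩⟩
  set D := Metric.ball p r with hD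
  have hDo : IsOpen D := Metric.isOpen_ball
  have hDc : Convex ℝ D := convex_ball p r
  have R : CPN.Regular f D := CPN.regular_of_contDiffOn hΩ hf hf0 hDo hball
  have hW : ∀ ξ ∈ D, CPN.W f ξ = 0 :=
    R.isSolution_iff.1 fun ξ hξ => hsol ξ (hball hξ)
  refine ⟨CPN.exists_isSurface R hDc hW, fun X hX hg => ?_⟩
  have e₁ : Set.EqOn (CPN.dzM X) (CPN.T₁ f) D := fun ξ hξ => hX.dzM_eq hξ
  have e₂ : Set.EqOn (CPN.dzbM X) (CPN.T₂ f) D := fun ξ hξ => hX.dzbM_eq hξ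
  have e₁₂ : Set.EqOn (CPN.dzM (CPN.dzbM X)) (CPN.T₁₂ f) D := fun ξ hξ => by
    rw [CPN.dzM_eqOn hDo e₂ hξ, R.dzM_T₂ hξ, hW ξ hξ, smul_zero, add_zero]
  have hg' : ∀ ξ ∈ D, CPN.metricDet (CPN.T₁ f) (CPN.T₂ f) ξ ≠ 0 := fun ξ hξ => by
    rw [← CPN.metricDet_congr e₁ e₂ hξ]
    exact hg ξ hξ
  constructor
  · obtain ⟨ν, hν⟩ := CPN.exists_isNormalFrame R hDc ⟨p, Metric.mem_ball_self hr⟩ hg'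
    exact ⟨ν, hν.congr e₁.symm e₂.symm⟩
  · intro ν hν
    have F : CPN.IsMovingFrame f ν D := ⟨R, hg', hν.congr e₁ e₂⟩
    have eA := CPN.A_congr (ν := ν) f hDo e₁.symm e₂.symm e₁₂.symm
    have eB := CPN.B_congr (ν := ν) f hDo e₁.symm e₂.symm e₁₂.symm
    refine ⟨fun ξ hξ => ?_, ?_, fun ξ hξ => F.S_add_S hξ, ?_⟩
    · simpa only [fun i => CPN.frame_congr (ν := ν) e₁ e₂ i hξ] using F.linearIndependent hξ
    · exact (F.gaussWeingarten hW).congr hDo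
        (fun i => CPN.frame_congr e₁.symm e₂.symm i) eA eB
    · exact (F.gaussCodazziRicci hW).congr hDo eA eB
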